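/- Let $1\le d\le n$ and $1\le k\le n$ be integers, let $a_1,\dots,a_n\in\mathbb R^d$ and $\lambda>0$. Let $$z_k=\min_{S\subseteq[n],\,|S|=k}\operatorname{tr}\Big(\big(\textstyle\sum_{i\in S}a_ia_i^\top+\lambda I_d\big)^{-1}\Big).$$ Let $A\in\mathbb R^{d\times n}$ be the matrix with columns $a_1,\dots,a_n$, let $C=A^\top A+\lambda I_n=H^\top H$ be the Cholesky factorization ($H$ upper triangular with positive diagonal), and let $h_i\in\mathbb R^n$ be the $i$-th column of $H$. For a positive semidefinite $Y\in\mathbb R^{n\times n}$ with eigenvalues $\beta_1\ge\dots\ge\beta_n\ge0$ put $$\Phi(Y)=\sum_{i=1}^{\iota}\frac1{\beta_i}+\frac{(k-\iota)^2}{\sum_{i=\iota+1}^n\beta_i},$$ where $\iota$ is the unique integer with $0\le\iota\le k-1$ and $\beta_\iota>\frac1{k-\iota}\sum_{i=\iota+1}^n\beta_i\ge\beta_{\iota+1}$ (with $\beta_0=\infty$). The AMESP-R relaxation value is $$\nu^M_k=\min_{x\in[0,1]^n}\Big\{\Phi\Big(\sum_{i=1}^n x_ih_ih_i^\top\Big)+\frac{d-k}{\lambda}:\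 \sum_{i=1}^n x_i=k\Big\}.$$ Then both minima are attained, and: (i) If $k\le d$, then $$1\le\frac{z_k}{\nu^M_k}\le\begin{cases}\min\left\{\frac{d-1}{d-k},\,n-k+1\right\}&\text{if }k\le d-1,\\ \min\{d,\,n-d+1\}&\text{if }k=d.\end{cases}$$ (ii) For all integers $d\ge1$, $k\ge d+1$ and $n>k$ there are $a_1,\dots,a_n\in\mathbb R^d$ and $\lambda>0$ with $\nu^M_k<0$ (for instance such vectors exist for $d=1$, $k=2$, $n=3$). -/

import Mathlib

open Matrix

namespace RAOD

/-- The `d × n` matrix `A` whose `i`-th column is the vector `a i`. -/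
def designMatrix {d n : ℕ} (a : Fin n → Fin d → ℝ) : Matrix (Fin d) (Fin n) ℝ :=
  (Matrix.of a)ᵀ

/-- The matrix `C = Aᵀ A + lam I_n`. -/
def covMatrix {d n : ℕ} (a : Fin n → Fin d → ℝ) (lam : ℝ) : Matrix (Fin n) (Fin n) ℝ :=
  (designMatrix a)ᵀ * designMatrix a + lam • (1 : Matrix (Fin n) (Fin n) ℝ)

theorem covMatrix_posDef {d n : ℕ} (a : Fin n → Fin d → ℝ) {lam : ℝ} (hlam : 0 < lam) :
    (covMatrix a lam).PosDef := by
  unfold covMatrix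
  refine Matrix.PosDef.posSemidef_add ?_ (Matrix.PosDef.one.smul hlam)
  simpa using Matrix.posSemidef_conjTranspose_mul_self (designMatrix a)

/-- The Cholesky factor of a real positive definite matrix `C`: the upper triangular matrix `H`
with positive diagonal and `Hᵀ H = C`, obtained from the decomposition `C = L D Lᵀ` as
`H = √D Lᵀ`. The three characterizing properties are proved below. -/
noncomputable def cholesky {n : ℕ} {C : Matrix (Fin n) (Fin n) ℝ} (hC : C.PosDef) :
    Matrix (Fin n) (Fin n) ℝ :=
  Matrix.diagonal (fun i => √(LDL.diagEntries hC i)) * (LDL.lower hC)ᵀ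

theorem diagEntries_pos {n : ℕ} {C : Matrix (Fin n) (Fin n) ℝ} (hC : C.PosDef) (i : Fin n) :
    0 < LDL.diagEntries hC i := by
  have hU : IsUnit (LDL.lowerInv hC) := isUnit_of_invertible _
  have h : (LDL.diag hC).PosDef := by
    rw [LDL.diag_eq_lowerInv_conj]
    exact hC.mul_mul_conjTranspose_same (Matrix.vecMul_injective_of_isUnit hU)
  simpa [LDL.diag] using h.diag_pos (i := i)

theorem cholesky_transpose_mul_self {n : ℕ} {C : Matrix (Fin n) (Fin n) ℝ} (hC : C.PosDef) :
    (cholesky hC)ᵀ * cholesky hC = C := by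
  conv_rhs => rw [← LDL.lower_conj_diag hC]
  have h : Matrix.diagonal (fun i => √(LDL.diagEntries hC i)) *
      Matrix.diagonal (fun i => √(LDL.diagEntries hC i)) = LDL.diag hC := by
    rw [Matrix.diagonal_mul_diagonal, LDL.diag]
    congr 1
    funext i
    exact Real.mul_self_sqrt (diagEntries_pos hC i).le
  simp only [cholesky, Matrix.transpose_mul, Matrix.transpose_transpose,
    Matrix.diagonal_transpose, Matrix.conjTranspose_eq_transpose_of_trivial]
  rw [← h]
  simp only [Matrix.mul_assoc]

theorem lower_upperTriangular {n : ℕ} {C : Matrix (Fin n) (Fin n) ℝ} (hC : C.PosDef) :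
    (LDL.lower hC)ᵀ.BlockTriangular id := by
  have h : ((LDL.lowerInv hC)ᵀ).BlockTriangular id := by
    intro i j hij
    exact LDL.lowerInv_triangular hC hij
  have hU : Invertible (LDL.lowerInv hC)ᵀ := inferInstance
  rw [LDL.lower, Matrix.transpose_nonsing_inv]
  exact Matrix.blockTriangular_inv_of_blockTriangular h

theorem cholesky_upperTriangular {n : ℕ} {C : Matrix (Fin n) (Fin n) ℝ} (hC : C.PosDef)
    {i j : Fin n} (hij : j < i) : cholesky hC i j = 0 := by
  rw [cholesky, Matrix.diagonal_mul, lower_upperTriangular hC hij, mul_zero]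

theorem lowerInv_diag {n : ℕ} {C : Matrix (Fin n) (Fin n) ℝ} (hC : C.PosDef) (i : Fin n) :
    LDL.lowerInv hC i i = 1 := by
  let _ := Cᵀ.toNormedAddCommGroup hC.transpose
  let _ := Cᵀ.toInnerProductSpace hC.transpose.posSemidef
  have h1 := congrFun (@InnerProductSpace.gramSchmidt_def'' ℝ (Fin n → ℝ) _
    (Cᵀ.toNormedAddCommGroup hC.transpose)
    (Cᵀ.toInnerProductSpace hC.transpose.posSemidef) (Fin n) _ _ _ (Pi.basisFun ℝ (Fin n)) i) i
  rw [Pi.add_apply, Finset.sum_apply, Finset.sum_eq_zero, add_zero] at h1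
  · rw [Pi.basisFun_apply, Pi.single_eq_same] at h1
    exact h1.symm
  · intro j hj
    have h2 : LDL.lowerInv hC j i = 0 := LDL.lowerInv_triangular hC (Finset.mem_Iio.1 hj)
    rw [Pi.smul_apply]
    exact smul_eq_zero_of_right _ h2

theorem cholesky_diag_pos {n : ℕ} {C : Matrix (Fin n) (Fin n) ℝ} (hC : C.PosDef)
    (i : Fin n) : 0 < cholesky hC i i := by
  have h : (LDL.lower hC * LDL.lowerInv hC) i i = 1 := by
    rw [LDL.lower, Matrix.inv_mul_of_invertible, Matrix.one_apply_eq]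
  rw [Matrix.mul_apply, Finset.sum_eq_single i, lowerInv_diag, mul_one] at h
  · rw [cholesky, Matrix.diagonal_mul, Matrix.transpose_apply, h, mul_one]
    exact Real.sqrt_pos.2 (diagEntries_pos hC i)
  · intro j _ hj
    rcases lt_or_gt_of_ne hj with h1 | h1
    · rw [LDL.lowerInv_triangular hC h1, mul_zero]
    · have h2 : LDL.lower hC i j = 0 := lower_upperTriangular hC h1
      rw [h2, zero_mul]
  · simp

/-- For `β_1 ≥ ⋯ ≥ β_m` (stored as `β 0, …, β (m - 1)`) and `k`, the integer `ι` satisfies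
`0 ≤ ι ≤ k - 1` and `β_ι > (1 / (k - ι)) ∑_{i > ι} β_i ≥ β_{ι + 1}`, where `β_0 = ∞`. -/
def IsSplitIndex {m : ℕ} (k : ℕ) (β : Fin m → ℝ) (ι : ℕ) : Prop :=
  ι < k ∧
  (∀ i : Fin m, (i : ℕ) + 1 = ι → (∑ j ∈ Finset.univ.filter (fun j : Fin m => ι ≤ (j : ℕ)), β j) / ((k : ℝ) - ι) < β i) ∧
  (∀ i : Fin m, (i : ℕ) = ι → β i ≤ (∑ j ∈ Finset.univ.filter (fun j : Fin m => ι ≤ (j : ℕ)), β j) / ((k : ℝ) - ι))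

theorem sum_tail_succ {m : ℕ} (β : Fin m → ℝ) (i : Fin m) :
    ∑ j ∈ Finset.univ.filter (fun j : Fin m => (i : ℕ) ≤ (j : ℕ)), β j =
      β i + ∑ j ∈ Finset.univ.filter (fun j : Fin m => (i : ℕ) + 1 ≤ (j : ℕ)), β j := by
  have h : Finset.univ.filter (fun j : Fin m => (i : ℕ) ≤ (j : ℕ)) =
      insert i (Finset.univ.filter (fun j : Fin m => (i : ℕ) + 1 ≤ (j : ℕ))) := by
    ext j
    simp only [Finset.mem_filter, Finset.mem_univ, true_and, Finset.mem_insert, Fin.ext_iff]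
    omega
  rw [h, Finset.sum_insert (by simp)]

/-- The splitting index exists and is unique. -/
theorem existsUnique_isSplitIndex {m k : ℕ} (hk : 1 ≤ k) (hkm : k ≤ m) (β : Fin m → ℝ)
    (hβ : Antitone β) (hβ0 : ∀ i, 0 ≤ β i) : ∃! ι, IsSplitIndex k β ι := by
  classical
  let T : ℕ → ℝ := fun t => ∑ j ∈ Finset.univ.filter (fun j : Fin m => t ≤ (j : ℕ)), β j
  have hT : ∀ i : Fin m, T i = β i + T (i + 1) := sum_tail_succ β
  have hT0 : ∀ t, 0 ≤ T t := fun t => Finset.sum_nonneg fun j _ => hβ0 j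
  let Q : ℕ → Prop := fun t => t < k ∧ ∀ i : Fin m, (i : ℕ) = t → β i ≤ T t / ((k : ℝ) - t)
  have hQ : ∃ t, Q t := by
    refine ⟨k - 1, by omega, fun i hi => ?_⟩
    have h1 : (k : ℝ) - ((k - 1 : ℕ) : ℝ) = 1 := by
      rw [Nat.cast_sub hk]; simp
    rw [h1, div_one, ← hi, hT i]
    linarith [hT0 (i + 1)]
  have hstep : ∀ i : Fin m, (i : ℕ) + 1 < k →
      (β i ≤ T i / ((k : ℝ) - (i : ℕ)) ↔
        β i ≤ T ((i : ℕ) + 1) / ((k : ℝ) - ((i : ℕ) + 1 : ℕ))) := by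
    intro i hi
    have h1 : ((i : ℕ) : ℝ) + 1 < k := by exact_mod_cast hi
    push_cast
    rw [le_div_iff₀ (by linarith), le_div_iff₀ (by linarith), hT i]
    constructor <;> intro h <;> linarith
  have hup : ∀ t s, Q t → t ≤ s → s < k → Q s := by
    intro t s ht hts
    induction s, hts using Nat.le_induction with
    | base => exact fun _ => ht
    | succ s _ ih =>
      intro hs
      obtain ⟨_, h2⟩ := ih (by omega)
      refine ⟨hs, fun i hi => ?_⟩
      have h3 := (hstep ⟨s, by omega⟩ hs).1 (h2 ⟨s, by omega⟩ rfl)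
      exact (hβ (Fin.le_def.2 (by simp [hi]))).trans h3
  have hiff : ∀ ι, IsSplitIndex k β ι ↔ Q ι ∧ ∀ t < ι, ¬ Q t := by
    intro ι
    constructor
    · rintro ⟨h1, h2, h3⟩
      refine ⟨⟨h1, h3⟩, fun t ht hQt => ?_⟩
      obtain ⟨s, rfl⟩ : ∃ s, ι = s + 1 := ⟨ι - 1, by omega⟩
      obtain ⟨_, h5⟩ := hup t s hQt (by omega) (by omega)
      have h6 := (hstep ⟨s, by omega⟩ h1).1 (h5 ⟨s, by omega⟩ rfl)
      exact absurd h6 (not_le.2 (h2 ⟨s, by omega⟩ rfl))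
    · rintro ⟨⟨h1, h3⟩, h4⟩
      refine ⟨h1, fun i hi => ?_, h3⟩
      subst hi
      by_contra hcon
      refine h4 i (by omega) ⟨by omega, fun j hj => ?_⟩
      obtain rfl : j = i := Fin.ext hj
      exact (hstep j h1).2 (not_lt.1 hcon)
  refine ⟨Nat.find hQ, (hiff _).2 ⟨Nat.find_spec hQ, fun t ht => Nat.find_min hQ ht⟩, ?_⟩
  intro ι hι
  obtain ⟨h1, h2⟩ := (hiff ι).1 hι
  refine le_antisymm (not_lt.1 fun h => h2 _ h (Nat.find_spec hQ)) (Nat.find_min' hQ h1)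

/-- The splitting index `ι` (the unique one, by `existsUnique_isSplitIndex`). -/
noncomputable def splitIndex {m : ℕ} (k : ℕ) (β : Fin m → ℝ) : ℕ :=
  sInf {ι | IsSplitIndex k β ι}

/-- `φ(β) = ∑_{i ≤ ι} 1 / β_i + (k - ι)² / ∑_{i > ι} β_i`. -/
noncomputable def phi {m : ℕ} (k : ℕ) (β : Fin m → ℝ) : ℝ :=
  (∑ i ∈ Finset.univ.filter (fun i : Fin m => (i : ℕ) < splitIndex k β), 1 / β i) +
    ((k : ℝ) - splitIndex k β) ^ 2 / ∑ i ∈ Finset.univ.filter (fun i : Fin m => splitIndex k β ≤ (i : ℕ)), β i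

/-- The spectral function `Φ(Y) = φ(β)` of a positive semidefinite matrix `Y`, where
`β_1 ≥ ⋯ ≥ β_n ≥ 0` are the eigenvalues of `Y` in nonincreasing order. -/
noncomputable def Phi {n : ℕ} (k : ℕ) (Y : Matrix (Fin n) (Fin n) ℝ) (hY : Y.PosSemidef) : ℝ :=
  phi k hY.isHermitian.eigenvalues₀

/-- `∑ i, x_i h_i h_iᵀ`, where `h_i` is the `i`-th column of `H`. -/
def weightedSum {n : ℕ} (H : Matrix (Fin n) (Fin n) ℝ) (x : Fin n → ℝ) :
    Matrix (Fin n) (Fin n) ℝ :=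
  ∑ i, x i • Matrix.vecMulVec (H.col i) (H.col i)

theorem weightedSum_posSemidef {n : ℕ} (H : Matrix (Fin n) (Fin n) ℝ) {x : Fin n → ℝ}
    (hx : ∀ i, x i ∈ Set.Icc (0 : ℝ) 1) : (weightedSum H x).PosSemidef := by
  unfold weightedSum
  refine Matrix.posSemidef_sum _ fun i _ => Matrix.PosSemidef.smul ?_ (hx i).1
  simpa using Matrix.posSemidef_vecMulVec_self_star (H.col i)

/-- The objective `f(S) = tr ((∑_{i ∈ S} a_i a_iᵀ + lam I_d)⁻¹)`. -/
noncomputable def objective {d n : ℕ} (a : Fin n → Fin d → ℝ) (lam : ℝ)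
    (S : Finset (Fin n)) : ℝ :=
  ((∑ i ∈ S, Matrix.vecMulVec (a i) (a i)) + lam • (1 : Matrix (Fin d) (Fin d) ℝ))⁻¹.trace

/-- The values of the regularized A-optimal design problem over all `S` with `|S| = k`. -/
def designValues {d n : ℕ} (a : Fin n → Fin d → ℝ) (lam : ℝ) (k : ℕ) : Set ℝ :=
  {v | ∃ S : Finset (Fin n), S.card = k ∧ v = objective a lam S}

/-- The optimal value `z_k` of the regularized A-optimal design problem. -/
noncomputable def z {d n : ℕ} (a : Fin n → Fin d → ℝ) (lam : ℝ) (k : ℕ) : ℝ :=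
  sInf (designValues a lam k)

/-- The values of the relaxation over all `x ∈ [0,1]^n` with `∑ x_i = k`. -/
def relaxationValues {d n : ℕ} (a : Fin n → Fin d → ℝ) {lam : ℝ} (hlam : 0 < lam) (k : ℕ) :
    Set ℝ :=
  {v | ∃ (x : Fin n → ℝ) (hx : ∀ i, x i ∈ Set.Icc (0 : ℝ) 1), ∑ i, x i = (k : ℝ) ∧
    v = Phi k (weightedSum (cholesky (covMatrix_posDef a hlam)) x)
      (weightedSum_posSemidef _ hx) + ((d : ℝ) - k) / lam}

/-- The optimal value `ν^M_k` of the relaxation. -/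
noncomputable def nuM {d n : ℕ} (a : Fin n → Fin d → ℝ) {lam : ℝ} (hlam : 0 < lam) (k : ℕ) :
    ℝ :=
  sInf (relaxationValues a hlam k)

end RAOD

/-! The eigenvalues `β` of `∑ x_i h_i h_iᵀ = H diag(x) Hᵀ` are those of `diag(x) C`, so only `C =
HᵀH` matters, and the coefficients of the characteristic polynomial give `e_j(β) = ∑_{|S| = j} x^S
det C_{S,S}` (`IsSpectrum.esymmOn_eq`). As `∑ x_i = k` with `x_i ≤ 1`, at least `k` of the `x_i` are
positive; hence `e_k(β) > 0` and the `k` largest eigenvalues are positive.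

At `x = 1_S` with `|S| = k`, exactly `k` eigenvalues are nonzero and `φ(β) = ∑ 1/β_i = e_{k-1}/e_k`.
The matrices `A_Sᵀ A_S + λ I_k` and `A_S A_Sᵀ + λ I_d` differ spectrally only in the multiplicity of
`λ`, so the objective at `S` is `φ(β) + (d-k)/λ` (`objective_eq_phi_add`). Thus `ν ≤ z`.

For the upper bound, draw `S` with probability proportional to `x^S det C_{S,S}`. The mean of `tr
C_{S,S}⁻¹` is a double sum over `T ⊂ S` with `|T| = k-1`; exchanging the sums gives each `x^T det
C_{T,T}` the factor `∑_{i ∉ T} x_i ≤ min(k, n-k+1)`. So the mean is at most `min(k, n-k+1)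
e_{k-1}(β)/e_k(β)`, and `e_{k-1} ≤ φ e_k` holds for every spectrum (`esymmOn_pred_le_phi_mul`). The
ratios in (i) follow, with the trivial bound `z ≤ d/λ` entering when `k < d`.

The relaxation attains its minimum because `φ` is continuous on finitely many compact pieces
covering the feasible spectra. For (ii), a diagonal `C` and constant `x` give a negative value. -/

namespace RAOD

/-! ### Elementary symmetric functions and double counting -/

section Combinatorics

variable {σ : Type*} [DecidableEq σ]

/-- The `j`-th elementary symmetric function of the values of `f` on `s`. -/
def esymmOn (s : Finset σ) (f : σ → ℝ) (j : ℕ) : ℝ :=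
  ∑ U ∈ s.powersetCard j, ∏ i ∈ U, f i

/-- Pairs `(U, i)` with `i ∉ U` correspond to pairs `(S, i)` with `i ∈ S` through `S = U ∪ {i}`.
This exchange serves both the inequality for `φ` and the averaging over random subsets. -/
theorem sum_powersetCard_sum_sdiff (s : Finset σ) (m : ℕ) (g : Finset σ → σ → ℝ) :
    ∑ U ∈ s.powersetCard m, ∑ i ∈ s \ U, g U i =
      ∑ S ∈ s.powersetCard (m + 1), ∑ i ∈ S, g (S.erase i) i := by
  rw [Finset.sum_sigma', Finset.sum_sigma']
  refine Finset.sum_bij' (fun p _ => ⟨insert p.2 p.1, p.2⟩) (fun p _ => ⟨p.1.erase p.2, p.2⟩)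
    ?_ ?_ ?_ ?_ ?_
  · rintro ⟨U, i⟩ h
    simp only [Finset.mem_sigma, Finset.mem_powersetCard, Finset.mem_sdiff] at h ⊢
    obtain ⟨⟨h1, h2⟩, h3, h4⟩ := h
    exact ⟨⟨Finset.insert_subset h3 h1, by rw [Finset.card_insert_of_notMem h4, h2]⟩,
      Finset.mem_insert_self _ _⟩
  · rintro ⟨S, i⟩ h
    simp only [Finset.mem_sigma, Finset.mem_powersetCard, Finset.mem_sdiff] at h ⊢
    obtain ⟨⟨h1, h2⟩, h3⟩ := h
    exact ⟨⟨(Finset.erase_subset _ _).trans h1, by rw [Finset.card_erase_of_mem h3, h2]; rfl⟩,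
      h1 h3, Finset.notMem_erase _ _⟩
  · rintro ⟨U, i⟩ h
    simp only [Finset.mem_sigma, Finset.mem_sdiff] at h
    simp [Finset.erase_insert h.2.2]
  · rintro ⟨S, i⟩ h
    simp only [Finset.mem_sigma] at h
    simp [Finset.insert_erase h.2]
  · rintro ⟨U, i⟩ h
    simp only [Finset.mem_sigma, Finset.mem_sdiff] at h
    simp [Finset.erase_insert h.2.2]

theorem sum_powersetCard_pred {S : Finset σ} {r : ℕ} (hS : S.card = r + 1) (g : Finset σ → ℝ) :
    ∑ U ∈ S.powersetCard r, g U = ∑ i ∈ S, g (S.erase i) := by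
  have h := sum_powersetCard_sum_sdiff S r fun U _ => g U
  have hps := Finset.powersetCard_self S
  rw [hS] at hps
  rw [hps, Finset.sum_singleton] at h
  rw [← h]
  refine Finset.sum_congr rfl fun U hU => ?_
  obtain ⟨hU1, hU2⟩ := Finset.mem_powersetCard.1 hU
  rw [Finset.sum_const, Finset.card_sdiff_of_subset hU1, hS, hU2]
  simp

theorem esymmOn_nonneg {σ : Type*} {s : Finset σ} {f : σ → ℝ} (hf : ∀ i ∈ s, 0 ≤ f i) (j : ℕ) :
    0 ≤ esymmOn s f j :=
  Finset.sum_nonneg fun _ hU => Finset.prod_nonneg fun i hi =>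
    hf i ((Finset.mem_powersetCard.1 hU).1 hi)

theorem esymmOn_insert_succ {s : Finset σ} {a : σ} (ha : a ∉ s) (f : σ → ℝ) (j : ℕ) :
    esymmOn (insert a s) f (j + 1) = esymmOn s f (j + 1) + f a * esymmOn s f j := by
  unfold esymmOn
  rw [Finset.powersetCard_succ_insert ha, Finset.sum_union, Finset.sum_image, Finset.mul_sum]
  · congr 1
    refine Finset.sum_congr rfl fun U hU => ?_
    rw [Finset.prod_insert fun h => ha ((Finset.mem_powersetCard.1 hU).1 h)]
  · intro U hU V hV h
    have hU' : a ∉ U := fun h => ha ((Finset.mem_powersetCard.1 hU).1 h)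
    have hV' : a ∉ V := fun h => ha ((Finset.mem_powersetCard.1 hV).1 h)
    rw [← Finset.erase_insert hU', h, Finset.erase_insert hV']
  · rw [Finset.disjoint_left]
    intro U hU hU'
    obtain ⟨V, _, rfl⟩ := Finset.mem_image.1 hU'
    exact ha ((Finset.mem_powersetCard.1 hU).1 (Finset.mem_insert_self _ _))

/-- Expand `T e_m`, with `T = ∑ f_i`, according to whether the extra index lies in `U`. The terms
with `i ∉ U` give `(m+1) e_{m+1}`; those with `i ∈ U` give at most `m/(m+1) · T e_m`, since each
`f_i ≤ T/(m+1)`. -/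
theorem sum_mul_esymmOn_le {s : Finset σ} {f : σ → ℝ} (hf : ∀ i ∈ s, 0 ≤ f i) (m : ℕ)
    (hle : ∀ i ∈ s, f i * (m + 1) ≤ ∑ j ∈ s, f j) :
    (∑ i ∈ s, f i) * esymmOn s f m ≤ (m + 1) ^ 2 * esymmOn s f (m + 1) := by
  set T := ∑ i ∈ s, f i with hT
  have h1 : ∑ U ∈ s.powersetCard m, ∑ i ∈ s \ U, f i * ∏ j ∈ U, f j =
      (m + 1) * esymmOn s f (m + 1) := by
    rw [sum_powersetCard_sum_sdiff s m fun U i => f i * ∏ j ∈ U, f j, esymmOn, Finset.mul_sum]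
    refine Finset.sum_congr rfl fun S hS => ?_
    rw [Finset.sum_congr rfl fun i hi => Finset.mul_prod_erase S f hi, Finset.sum_const,
      (Finset.mem_powersetCard.1 hS).2, nsmul_eq_mul]
    push_cast
    rfl
  have h2 : (m + 1) * ∑ U ∈ s.powersetCard m, ∑ i ∈ U, f i * ∏ j ∈ U, f j ≤
      m * (T * esymmOn s f m) := by
    rw [esymmOn, Finset.mul_sum, Finset.mul_sum, Finset.mul_sum]
    refine Finset.sum_le_sum fun U hU => ?_
    obtain ⟨hUs, hUc⟩ := Finset.mem_powersetCard.1 hU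
    rw [← Finset.sum_mul, ← mul_assoc, ← mul_assoc]
    refine mul_le_mul_of_nonneg_right ?_ (Finset.prod_nonneg fun i hi => hf i (hUs hi))
    rw [Finset.mul_sum]
    calc ∑ i ∈ U, ((m : ℝ) + 1) * f i ≤ ∑ _i ∈ U, T :=
          Finset.sum_le_sum fun i hi => by rw [mul_comm]; exact hle i (hUs hi)
      _ = m * T := by rw [Finset.sum_const, hUc, nsmul_eq_mul]
  have h3 : T * esymmOn s f m = ∑ U ∈ s.powersetCard m, ∑ i ∈ s \ U, f i * ∏ j ∈ U, f j +
      ∑ U ∈ s.powersetCard m, ∑ i ∈ U, f i * ∏ j ∈ U, f j := by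
    rw [esymmOn, Finset.mul_sum, ← Finset.sum_add_distrib]
    refine Finset.sum_congr rfl fun U hU => ?_
    rw [Finset.sum_sdiff (Finset.mem_powersetCard.1 hU).1, Finset.sum_mul]
  rw [h1] at h3
  nlinarith

/-- Induction on the large entries `s`. If `e_j ≤ R e_{j+1}`, adjoining `a` gives `e_{j+1} + f_a e_j
≤ (1/f_a + R)(e_{j+2} + f_a e_{j+1})`: the right side already contains `e_{j+1}` and `R f_a
e_{j+1}`, and its other terms are nonnegative. -/
theorem esymmOn_union_le {s t : Finset σ} (hst : Disjoint s t) {f : σ → ℝ}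
    (hs : ∀ i ∈ s, 0 < f i) (ht : ∀ i ∈ t, 0 ≤ f i) (hT : 0 < ∑ i ∈ t, f i) (m : ℕ)
    (hle : ∀ i ∈ t, f i * (m + 1) ≤ ∑ j ∈ t, f j) :
    esymmOn (s ∪ t) f (m + s.card) ≤
      (∑ i ∈ s, 1 / f i + (m + 1) ^ 2 / ∑ i ∈ t, f i) * esymmOn (s ∪ t) f (m + s.card + 1) := by
  induction s using Finset.induction_on with
  | empty =>
    have h := sum_mul_esymmOn_le ht m hle
    simp only [Finset.empty_union, Finset.card_empty, add_zero, Finset.sum_empty, zero_add]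
    rw [div_mul_eq_mul_div, le_div_iff₀ hT]
    linarith
  | insert a s ha ih =>
    rw [Finset.disjoint_insert_left] at hst
    have hs' : ∀ i ∈ s, 0 < f i := fun i hi => hs i (Finset.mem_insert_of_mem hi)
    have ih := ih hst.2 hs'
    have hnn : ∀ j, 0 ≤ esymmOn (s ∪ t) f j := esymmOn_nonneg fun i hi =>
      (Finset.mem_union.1 hi).elim (fun h => (hs' i h).le) (ht i)
    have hat : a ∉ s ∪ t := by simp [ha, hst.1]
    have hfa : 0 < f a := hs a (Finset.mem_insert_self _ _)
    have hR : 0 ≤ ∑ i ∈ s, 1 / f i + (m + 1 : ℝ) ^ 2 / ∑ i ∈ t, f i :=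
      add_nonneg (Finset.sum_nonneg fun i hi => (one_div_pos.2 (hs' i hi)).le) (by positivity)
    rw [Finset.insert_union, Finset.card_insert_of_notMem ha, Finset.sum_insert ha, ← add_assoc,
      esymmOn_insert_succ hat, esymmOn_insert_succ hat]
    set R := ∑ i ∈ s, 1 / f i + (m + 1 : ℝ) ^ 2 / ∑ i ∈ t, f i with hRdef
    have e : 1 / f a + ∑ i ∈ s, 1 / f i + (m + 1 : ℝ) ^ 2 / ∑ i ∈ t, f i = 1 / f a + R := by
      rw [hRdef]; ring
    rw [e]
    have e1 : 1 / f a * (f a * esymmOn (s ∪ t) f (m + s.card + 1)) =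
        esymmOn (s ∪ t) f (m + s.card + 1) := by field_simp
    have e2 := mul_nonneg (add_nonneg (one_div_pos.2 hfa).le hR) (hnn (m + s.card + 1 + 1))
    have e3 := mul_le_mul_of_nonneg_left ih hfa.le
    nlinarith

end Combinatorics

/-! ### The splitting index and the function `φ` -/

section Split

variable {m : ℕ}

/-- `∑_{i ≥ ι} β_i`. -/
def tailSum (ι : ℕ) (β : Fin m → ℝ) : ℝ :=
  ∑ j ∈ Finset.univ.filter (fun j : Fin m => ι ≤ (j : ℕ)), β j

/-- `∑_{i < ι} 1 / β_i + (k - ι)² / ∑_{i ≥ ι} β_i`. -/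
noncomputable def splitValue (k ι : ℕ) (β : Fin m → ℝ) : ℝ :=
  (∑ i ∈ Finset.univ.filter (fun i : Fin m => (i : ℕ) < ι), 1 / β i) +
    ((k : ℝ) - ι) ^ 2 / tailSum ι β

/-- The closed version of `IsSplitIndex`. -/
def IsWeakSplitIndex (k : ℕ) (β : Fin m → ℝ) (ι : ℕ) : Prop :=
  ι < k ∧ (∀ i : Fin m, (i : ℕ) + 1 = ι → tailSum ι β / ((k : ℝ) - ι) ≤ β i) ∧
  (∀ i : Fin m, (i : ℕ) = ι → β i ≤ tailSum ι β / ((k : ℝ) - ι))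

theorem IsSplitIndex.isWeakSplitIndex {k ι : ℕ} {β : Fin m → ℝ} (h : IsSplitIndex k β ι) :
    IsWeakSplitIndex k β ι :=
  ⟨h.1, fun i hi => (h.2.1 i hi).le, h.2.2⟩

theorem tailSum_eq_add (β : Fin m → ℝ) (i : Fin m) :
    tailSum i β = β i + tailSum (i + 1) β :=
  sum_tail_succ β i

theorem tailSum_pos {k ι : ℕ} {β : Fin m → ℝ} (hβ0 : ∀ i, 0 ≤ β i)
    (hpos : ∀ i : Fin m, (i : ℕ) < k → 0 < β i) (hι : ι < k) (hk : k ≤ m) : 0 < tailSum ι β := by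
  rw [show ι = ((⟨ι, by omega⟩ : Fin m) : ℕ) from rfl, tailSum_eq_add]
  exact add_pos_of_pos_of_nonneg (hpos _ hι) (Finset.sum_nonneg fun i _ => hβ0 i)

theorem splitIndex_eq {k ι : ℕ} {β : Fin m → ℝ} (hk : 1 ≤ k) (hkm : k ≤ m) (hβ : Antitone β)
    (hβ0 : ∀ i, 0 ≤ β i) (h : IsSplitIndex k β ι) : splitIndex k β = ι := by
  have h1 : {ι | IsSplitIndex k β ι} = {ι} := by
    ext κ
    exact ⟨fun h2 => (existsUnique_isSplitIndex hk hkm β hβ hβ0).unique h2 h, fun h2 => h2 ▸ h⟩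
  rw [splitIndex, h1, csInf_singleton]

theorem isSplitIndex_splitIndex {k : ℕ} {β : Fin m → ℝ} (hk : 1 ≤ k) (hkm : k ≤ m)
    (hβ : Antitone β) (hβ0 : ∀ i, 0 ≤ β i) : IsSplitIndex k β (splitIndex k β) := by
  obtain ⟨ι, hι, -⟩ := existsUnique_isSplitIndex hk hkm β hβ hβ0
  rwa [splitIndex_eq hk hkm hβ hβ0 hι]

theorem phi_eq_splitValue_splitIndex (k : ℕ) (β : Fin m → ℝ) :
    phi k β = splitValue k (splitIndex k β) β := rfl

/-- The formulas for neighbouring indices agree where the strict inequality degenerates to equality,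
so a weak index can be lowered until it is the true one. The closed conditions make compactness
arguments possible. -/
theorem phi_eq_splitValue {k ι : ℕ} {β : Fin m → ℝ} (hk : 1 ≤ k) (hkm : k ≤ m) (hβ : Antitone β)
    (hβ0 : ∀ i, 0 ≤ β i) (hpos : ∀ i : Fin m, (i : ℕ) < k → 0 < β i)
    (h : IsWeakSplitIndex k β ι) : phi k β = splitValue k ι β := by
  induction ι with
  | zero => rw [phi_eq_splitValue_splitIndex, splitIndex_eq hk hkm hβ hβ0
      ⟨h.1, fun i hi => absurd hi (Nat.succ_ne_zero _), h.2.2⟩]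
  | succ ι ih =>
    obtain ⟨h1, h2, h3⟩ := h
    let i : Fin m := ⟨ι, by omega⟩
    rcases (h2 i rfl).lt_or_eq with h4 | h4
    · rw [phi_eq_splitValue_splitIndex, splitIndex_eq hk hkm hβ hβ0 (ι := ι + 1)
        ⟨h1, fun j hj => ?_, h3⟩]
      obtain rfl : j = i := Fin.ext (by simpa [i] using hj)
      exact h4
    -- In the tie, the tail from `ι + 1` is `(k-ι-1) β_i` and the tail from `ι` is `(k-ι) β_i`, so
    -- both split values have the same last part `(k-ι)/β_i`.
    · have hc : (0 : ℝ) < (k : ℝ) - (ι + 1 : ℕ) := by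
        rw [sub_pos]; exact_mod_cast h1
      have hc' : (0 : ℝ) < (k : ℝ) - ι := by push_cast at hc; linarith
      have hT : tailSum ι β = β i + tailSum (ι + 1) β := tailSum_eq_add β i
      have hT1 : tailSum (ι + 1) β = β i * ((k : ℝ) - (ι + 1 : ℕ)) := by
        rw [← h4, div_mul_cancel₀ _ hc.ne']
      have hT2 : tailSum ι β = β i * ((k : ℝ) - ι) := by
        rw [hT, hT1]; push_cast; ring
      have hi : 0 < β i := hpos i (by simp [i]; omega)
      have hq : tailSum ι β / ((k : ℝ) - ι) = β i := by
        rw [hT2, mul_div_cancel_right₀ _ hc'.ne']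
      rw [ih ⟨by omega, fun j hj => ?_, fun j hj => ?_⟩]
      · have hf : Finset.univ.filter (fun j : Fin m => (j : ℕ) < ι + 1) =
            insert i (Finset.univ.filter (fun j : Fin m => (j : ℕ) < ι)) := by
          ext j
          simp only [Finset.mem_filter, Finset.mem_univ, true_and, Finset.mem_insert,
            Fin.ext_iff, i]
          omega
        rw [splitValue, splitValue, hf, Finset.sum_insert (by simp [i]), hT1, hT2]
        have hc2 : (k : ℝ) - (ι + 1 : ℕ) = (k : ℝ) - ι - 1 := by push_cast; ring
        rw [hc2] at hc ⊢
        field_simp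
        ring
      · rw [hq]
        exact hβ (Fin.le_def.2 (by simp [i]; omega))
      · rw [hq]
        exact hβ (Fin.le_def.2 (by simp [i]; omega))

theorem phi_pos {k : ℕ} {β : Fin m → ℝ} (hk : 1 ≤ k) (hkm : k ≤ m) (hβ : Antitone β)
    (hβ0 : ∀ i, 0 ≤ β i) (hpos : ∀ i : Fin m, (i : ℕ) < k → 0 < β i) : 0 < phi k β := by
  have h := isSplitIndex_splitIndex hk hkm hβ hβ0
  have hc : (0 : ℝ) < (k : ℝ) - splitIndex k β := by rw [sub_pos]; exact_mod_cast h.1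
  have hT := tailSum_pos hβ0 hpos h.1 hkm
  rw [phi_eq_splitValue_splitIndex, splitValue]
  exact add_pos_of_nonneg_of_pos
    (Finset.sum_nonneg fun i _ => one_div_nonneg.2 (hβ0 i)) (by positivity)

/-- The splitting condition is exactly the hypothesis of `esymmOn_union_le`: after the first `ι`
entries, none exceeds the tail sum divided by `k - ι`. -/
theorem esymmOn_pred_le_phi_mul {k : ℕ} {β : Fin m → ℝ} (hk : 1 ≤ k) (hkm : k ≤ m)
    (hβ : Antitone β) (hβ0 : ∀ i, 0 ≤ β i) (hpos : ∀ i : Fin m, (i : ℕ) < k → 0 < β i) :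
    esymmOn Finset.univ β (k - 1) ≤ phi k β * esymmOn Finset.univ β k := by
  have h := isSplitIndex_splitIndex hk hkm hβ hβ0
  rw [phi_eq_splitValue_splitIndex]
  generalize splitIndex k β = ι at h
  have hι := h.1
  obtain ⟨r, rfl⟩ : ∃ r, k = r + ι + 1 := ⟨k - ι - 1, by omega⟩
  have hu : Finset.univ.filter (fun i : Fin m => (i : ℕ) < ι) ∪
      Finset.univ.filter (fun i : Fin m => ι ≤ (i : ℕ)) = Finset.univ := by
    ext i; simp; omega
  have hcard : (Finset.univ.filter (fun i : Fin m => (i : ℕ) < ι)).card = ι := by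
    rw [Fin.card_filter_val_lt]; omega
  have hc : ((r + ι + 1 : ℕ) : ℝ) - ι = r + 1 := by push_cast; ring
  have key := esymmOn_union_le (s := Finset.univ.filter (fun i : Fin m => (i : ℕ) < ι))
    (t := Finset.univ.filter (fun i : Fin m => ι ≤ (i : ℕ))) (f := β)
    (Finset.disjoint_filter.2 fun i _ h1 h2 => by omega)
    (fun i hi => hpos i (by simp at hi; omega)) (fun i _ => hβ0 i)
    (tailSum_pos hβ0 hpos hι hkm) r (fun i hi => ?_)
  · rw [hu, hcard] at key
    rw [splitValue, hc]
    exact key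
  · have h3 := h.2.2 ⟨ι, by omega⟩ rfl
    rw [hc, le_div_iff₀ (by positivity)] at h3
    refine le_trans (mul_le_mul_of_nonneg_right (hβ ?_) (by positivity)) h3
    simp at hi
    exact Fin.le_def.2 hi

theorem pos_of_esymmOn_pos {k : ℕ} {β : Fin m → ℝ} (hβ : Antitone β) (hβ0 : ∀ i, 0 ≤ β i)
    (h : 0 < esymmOn Finset.univ β k) (i : Fin m) (hi : (i : ℕ) < k) : 0 < β i := by
  obtain ⟨U, hU, hne⟩ := Finset.exists_ne_zero_of_sum_ne_zero h.ne'
  by_contra hcon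
  refine hne (Finset.prod_eq_zero_iff.2 ?_)
  by_contra hcon2
  push Not at hcon2
  have hsub : U ⊆ Finset.univ.filter (fun j : Fin m => (j : ℕ) < i) := by
    intro j hj
    simp only [Finset.mem_filter, Finset.mem_univ, true_and]
    by_contra hlt
    exact hcon2 j hj (le_antisymm ((hβ (Fin.le_def.2 (not_lt.1 hlt))).trans (not_lt.1 hcon))
      (hβ0 j))
  have h1 := Finset.card_le_card hsub
  rw [(Finset.mem_powersetCard.1 hU).2, Fin.card_filter_val_lt] at h1
  omega

theorem eq_zero_of_esymmOn_eq_zero {k : ℕ} {β : Fin m → ℝ} (hβ : Antitone β) (hβ0 : ∀ i, 0 ≤ β i)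
    (h : esymmOn Finset.univ β (k + 1) = 0) (i : Fin m) (hi : k ≤ (i : ℕ)) : β i = 0 := by
  have h1 := (Finset.sum_eq_zero_iff_of_nonneg fun U _ =>
    Finset.prod_nonneg fun i _ => hβ0 i).1 h
    (Finset.univ.filter (fun j : Fin m => (j : ℕ) < k + 1)) (Finset.mem_powersetCard.2
      ⟨Finset.subset_univ _, by rw [Fin.card_filter_val_lt]; omega⟩)
  obtain ⟨j, hj, hj0⟩ := Finset.prod_eq_zero_iff.1 h1
  simp at hj
  exact le_antisymm (hj0 ▸ hβ (Fin.le_def.2 (by omega))) (hβ0 i)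

/-- If only the `k` largest entries are nonzero, `φ` is the sum of the reciprocals of the
nonzero entries. -/
theorem phi_eq_sum_inv {k : ℕ} {β : Fin m → ℝ} (hk : 1 ≤ k) (hkm : k ≤ m)
    (hβ : Antitone β) (hβ0 : ∀ i, 0 ≤ β i) (hpos : ∀ i : Fin m, (i : ℕ) < k → 0 < β i)
    (hzero : ∀ i : Fin m, k ≤ (i : ℕ) → β i = 0) : phi k β = ∑ i, (β i)⁻¹ := by
  obtain ⟨r, rfl⟩ : ∃ r, k = r + 1 := ⟨k - 1, by omega⟩
  let i : Fin m := ⟨r, by omega⟩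
  have ht : tailSum (r + 1) β = 0 := Finset.sum_eq_zero fun j hj => hzero j (by simpa using hj)
  have ht' : tailSum r β = β i := by
    rw [show r = (i : ℕ) from rfl, tailSum_eq_add]; simp [i, ht]
  have hc : ((r + 1 : ℕ) : ℝ) - r = 1 := by push_cast; ring
  -- The tail from `r = k - 1` is the single entry `β i`, so `r` is a weak split index; it need not
  -- be the strict one, as `β i` may equal its predecessor.
  rw [phi_eq_splitValue hk hkm hβ hβ0 hpos (ι := r)
    ⟨by omega, fun j hj => ?_, fun j hj => ?_⟩, splitValue, hc, ht',
    ← Finset.sum_subset (Finset.subset_univ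
      (insert i (Finset.univ.filter (fun j : Fin m => (j : ℕ) < r)))), Finset.sum_insert (by simp [i])]
  · simp [add_comm]
  · intro j _ hj
    rw [hzero j, _root_.inv_zero]
    simp [Fin.ext_iff, i] at hj
    omega
  · rw [hc, ht', div_one]
    exact hβ (Fin.le_def.2 (by simp [i]; omega))
  · rw [hc, ht', div_one]
    exact hβ (Fin.le_def.2 (by simp [i]; omega))

/-- If only the `k` largest entries are nonzero, `φ` is a quotient of elementary symmetric
functions. -/
theorem phi_mul_esymmOn {k : ℕ} {β : Fin m → ℝ} (hk : 1 ≤ k) (hkm : k ≤ m)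
    (hβ : Antitone β) (hβ0 : ∀ i, 0 ≤ β i) (hpos : ∀ i : Fin m, (i : ℕ) < k → 0 < β i)
    (hzero : ∀ i : Fin m, k ≤ (i : ℕ) → β i = 0) :
    phi k β * esymmOn Finset.univ β k = esymmOn Finset.univ β (k - 1) := by
  set s := Finset.univ.filter (fun i : Fin m => (i : ℕ) < k) with hs
  have hcard : s.card = k := by rw [hs, Fin.card_filter_val_lt]; omega
  have hred : ∀ j, esymmOn Finset.univ β j = esymmOn s β j := by
    intro j
    refine (Finset.sum_subset (Finset.powersetCard_mono (Finset.subset_univ _)) ?_).symm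
    intro U hU hU'
    rw [Finset.mem_powersetCard] at hU hU'
    obtain ⟨i, hi, his⟩ := Finset.not_subset.1 fun h => hU' ⟨h, hU.2⟩
    exact Finset.prod_eq_zero hi (hzero i (by simpa [hs] using his))
  obtain ⟨r, rfl⟩ : ∃ r, k = r + 1 := ⟨k - 1, by omega⟩
  have h1 : esymmOn s β (r + 1) = ∏ i ∈ s, β i := by
    have := Finset.powersetCard_self s
    rw [hcard] at this
    rw [esymmOn, this, Finset.sum_singleton]
  have h2 : esymmOn s β r = ∑ i ∈ s, ∏ j ∈ s.erase i, β j :=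
    sum_powersetCard_pred hcard fun U => ∏ j ∈ U, β j
  rw [hred, hred, phi_eq_sum_inv hk hkm hβ hβ0 hpos hzero, Nat.add_sub_cancel, h1, h2,
    ← Finset.sum_subset (Finset.subset_univ s), Finset.sum_mul]
  · refine Finset.sum_congr rfl fun i hi => ?_
    have hi0 : β i ≠ 0 := (hpos i (by simpa [hs] using hi)).ne'
    rw [← Finset.mul_prod_erase s β hi, inv_mul_cancel_left₀ hi0]
  · intro i _ hi
    rw [hzero i (by simpa [hs] using hi), _root_.inv_zero]

end Split

/-! ### Spectra of `diag(x) C` and principal minors -/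

section Spectrum

variable {n m : ℕ}

/-- `β` lists in nonincreasing order the (nonnegative) eigenvalues of `diag(x) C`. -/
structure IsSpectrum (C : Matrix (Fin n) (Fin n) ℝ) (x : Fin n → ℝ) (β : Fin m → ℝ) : Prop where
  antitone : Antitone β
  nonneg : ∀ i, 0 ≤ β i
  prod_eq : ∏ i, (Polynomial.X - Polynomial.C (β i)) = (diagonal x * C).charpoly

theorem IsSpectrum.eq {C : Matrix (Fin n) (Fin n) ℝ} {x : Fin n → ℝ} {β γ : Fin m → ℝ}
    (hβ : IsSpectrum C x β) (hγ : IsSpectrum C x γ) : β = γ := by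
  have hroots : ∀ δ : Fin m → ℝ, (∏ i, (Polynomial.X - Polynomial.C (δ i))).roots =
      (List.ofFn δ : Multiset ℝ) := fun δ => by
    rw [Polynomial.roots_prod _ _ (Finset.prod_ne_zero_iff.2 fun i _ =>
      Polynomial.X_sub_C_ne_zero _)]
    simp [Fin.univ_val_map]
  have h : (List.ofFn β : Multiset ℝ) = (List.ofFn γ : Multiset ℝ) := by
    rw [← hroots, ← hroots, hβ.prod_eq, hγ.prod_eq]
  exact List.ofFn_injective (List.Perm.eq_of_sortedGE hβ.antitone.sortedGE_ofFn
    hγ.antitone.sortedGE_ofFn (Multiset.coe_eq_coe.1 h))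

theorem weightedSum_eq (H : Matrix (Fin n) (Fin n) ℝ) (x : Fin n → ℝ) :
    weightedSum H x = H * diagonal x * Hᵀ := by
  ext i j
  rw [weightedSum, Matrix.sum_apply, Matrix.mul_apply]
  refine Finset.sum_congr rfl fun l _ => ?_
  rw [Matrix.smul_apply, vecMulVec_apply, mul_diagonal, transpose_apply, smul_eq_mul]
  simp only [col_apply]
  ring

theorem charpoly_weightedSum (H : Matrix (Fin n) (Fin n) ℝ) (x : Fin n → ℝ) :
    (weightedSum H x).charpoly = (diagonal x * (Hᵀ * H)).charpoly := by
  rw [weightedSum_eq, Matrix.mul_assoc, charpoly_mul_comm, Matrix.mul_assoc]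

theorem isSpectrum_eigenvalues₀ (H : Matrix (Fin n) (Fin n) ℝ) (x : Fin n → ℝ)
    (hY : (weightedSum H x).PosSemidef) :
    IsSpectrum (Hᵀ * H) x hY.isHermitian.eigenvalues₀ where
  antitone := hY.isHermitian.eigenvalues₀_antitone
  nonneg i := by
    have h := hY.eigenvalues_nonneg
      (((Fintype.equivOfCardEq (Fintype.card_fin (Fintype.card (Fin n))) :
        Fin (Fintype.card (Fin n)) ≃ Fin n)) i)
    rw [IsHermitian.eigenvalues] at h
    simpa using h
  prod_eq := by
    rw [← charpoly_weightedSum, hY.isHermitian.charpoly_eq]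
    unfold IsHermitian.eigenvalues
    exact (Equiv.prod_comp (Fintype.equivOfCardEq (Fintype.card_fin _)).symm
      fun i => Polynomial.X - Polynomial.C (hY.isHermitian.eigenvalues₀ i)).symm

/-- `det C_{S,S}`. -/
def principalMinor (C : Matrix (Fin n) (Fin n) ℝ) (S : Finset (Fin n)) : ℝ :=
  (C.submatrix (Subtype.val : S → Fin n) (Subtype.val : S → Fin n)).det

/-- `∑_{|S| = j} x^S det C_{S,S}`. -/
def minorSum (C : Matrix (Fin n) (Fin n) ℝ) (x : Fin n → ℝ) (j : ℕ) : ℝ :=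
  ∑ S ∈ Finset.univ.powersetCard j, (∏ i ∈ S, x i) * principalMinor C S

theorem principalMinor_diagonal_mul (C : Matrix (Fin n) (Fin n) ℝ) (x : Fin n → ℝ)
    (S : Finset (Fin n)) :
    principalMinor (diagonal x * C) S = (∏ i ∈ S, x i) * principalMinor C S := by
  have h : (diagonal x * C).submatrix (Subtype.val : S → Fin n) (Subtype.val : S → Fin n) =
      diagonal (fun i : S => x i) *
        C.submatrix (Subtype.val : S → Fin n) (Subtype.val : S → Fin n) := by
    ext i j
    simp [diagonal_mul]
  rw [principalMinor, h, det_mul, det_diagonal, principalMinor, Finset.prod_coe_sort S x]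

theorem principalMinor_pos {C : Matrix (Fin n) (Fin n) ℝ} (hC : C.PosDef) (S : Finset (Fin n)) :
    0 < principalMinor C S :=
  (hC.submatrix Subtype.val_injective).det_pos

/-- Both sides are, up to the sign `(-1)^j`, the coefficient of `X^(n-j)` in the characteristic
polynomial of `diag(x) C`. -/
theorem IsSpectrum.esymmOn_eq {C : Matrix (Fin n) (Fin n) ℝ} {x : Fin n → ℝ} {β : Fin m → ℝ}
    (h : IsSpectrum C x β) {j : ℕ} (hj : j ≤ n) :
    esymmOn Finset.univ β j = minorSum C x j := by
  have hmn : m = n := by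
    have h1 := congrArg Polynomial.natDegree h.prod_eq
    rw [charpoly_natDegree_eq_dim, Polynomial.natDegree_prod_of_monic _ _
      fun i _ => Polynomial.monic_X_sub_C _] at h1
    simpa using h1
  subst hmn
  have h1 := charpoly_coeff_eq_sum_minors (diagonal x * C) j (by simpa using hj)
  have h2 := Multiset.prod_X_sub_C_coeff (Finset.univ.val.map β) (k := m - j) (by simp)
  rw [Multiset.map_map] at h2
  have h3 : ((Finset.univ.val.map ((fun t : ℝ => Polynomial.X - Polynomial.C t) ∘ β)).prod) =
      (diagonal x * C).charpoly := h.prod_eq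
  rw [h3] at h2
  rw [Fintype.card_fin, h2] at h1
  simp only [Multiset.card_map, Finset.card_val, Finset.card_univ, Fintype.card_fin,
    Nat.sub_sub_self hj] at h1
  have h4 := mul_left_cancel₀ (pow_ne_zero j (by norm_num : (-1 : ℝ) ≠ 0)) h1
  rw [Finset.esymm_map_val] at h4
  rw [esymmOn, h4, minorSum]
  exact Finset.sum_congr rfl fun S _ => principalMinor_diagonal_mul C x S

theorem le_card_support {x : Fin n → ℝ} (hx : ∀ i, x i ∈ Set.Icc (0 : ℝ) 1) {k : ℕ}
    (hsum : ∑ i, x i = k) : k ≤ (Finset.univ.filter fun i => 0 < x i).card := by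
  have h : (k : ℝ) ≤ (Finset.univ.filter fun i => 0 < x i).card := by
    rw [← hsum, ← Finset.sum_subset (Finset.subset_univ (Finset.univ.filter fun i => 0 < x i))]
    · refine (Finset.sum_le_sum fun i _ => (hx i).2).trans ?_
      simp
    · intro i _ hi
      simp only [Finset.mem_filter, Finset.mem_univ, true_and, not_lt] at hi
      exact le_antisymm hi (hx i).1
  exact_mod_cast h

theorem minorSum_pos {C : Matrix (Fin n) (Fin n) ℝ} (hC : C.PosDef) {x : Fin n → ℝ}
    (hx : ∀ i, x i ∈ Set.Icc (0 : ℝ) 1) {k : ℕ} (hsum : ∑ i, x i = k) : 0 < minorSum C x k := by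
  obtain ⟨S, hS, hcard⟩ := Finset.exists_subset_card_eq (le_card_support hx hsum)
  refine Finset.sum_pos' (fun T _ => mul_nonneg (Finset.prod_nonneg fun i _ => (hx i).1)
    (principalMinor_pos hC T).le) ⟨S, by simp [hcard], ?_⟩
  exact mul_pos (Finset.prod_pos fun i hi => (Finset.mem_filter.1 (hS hi)).2)
    (principalMinor_pos hC S)

theorem IsSpectrum.pos {C : Matrix (Fin n) (Fin n) ℝ} (hC : C.PosDef) {x : Fin n → ℝ}
    (hx : ∀ i, x i ∈ Set.Icc (0 : ℝ) 1) {k : ℕ} (hsum : ∑ i, x i = k) (hk : k ≤ n)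
    {β : Fin m → ℝ} (h : IsSpectrum C x β) (i : Fin m) (hi : (i : ℕ) < k) : 0 < β i :=
  pos_of_esymmOn_pos h.antitone h.nonneg (h.esymmOn_eq hk ▸ minorSum_pos hC hx hsum) i hi

/-- The indicator vector of `S`. -/
def indicatorVec (S : Finset (Fin n)) (i : Fin n) : ℝ := if i ∈ S then 1 else 0

theorem indicatorVec_mem (S : Finset (Fin n)) (i : Fin n) :
    indicatorVec S i ∈ Set.Icc (0 : ℝ) 1 := by
  unfold indicatorVec
  split_ifs <;> simp

theorem sum_indicatorVec (S : Finset (Fin n)) : ∑ i, indicatorVec S i = S.card := by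
  simp [indicatorVec]

theorem prod_indicatorVec (S T : Finset (Fin n)) :
    ∏ i ∈ T, indicatorVec S i = if T ⊆ S then 1 else 0 := by
  split_ifs with h
  · exact Finset.prod_eq_one fun i hi => by rw [indicatorVec, if_pos (h hi)]
  · obtain ⟨i, hi, hiS⟩ := Finset.not_subset.1 h
    exact Finset.prod_eq_zero hi (by rw [indicatorVec, if_neg hiS])

theorem minorSum_indicatorVec (C : Matrix (Fin n) (Fin n) ℝ) (S : Finset (Fin n)) (j : ℕ) :
    minorSum C (indicatorVec S) j = ∑ T ∈ S.powersetCard j, principalMinor C T := by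
  rw [minorSum, ← Finset.sum_subset (Finset.powersetCard_mono (Finset.subset_univ S))]
  · refine Finset.sum_congr rfl fun T hT => ?_
    rw [prod_indicatorVec, if_pos (Finset.mem_powersetCard.1 hT).1, one_mul]
  · intro T hT hT'
    rw [Finset.mem_powersetCard] at hT hT'
    rw [prod_indicatorVec, if_neg fun h => hT' ⟨h, hT.2⟩, zero_mul]

theorem IsSpectrum.eq_zero {C : Matrix (Fin n) (Fin n) ℝ} {S : Finset (Fin n)} {β : Fin n → ℝ}
    (h : IsSpectrum C (indicatorVec S) β) (i : Fin n) (hi : S.card ≤ (i : ℕ)) : β i = 0 := by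
  refine eq_zero_of_esymmOn_eq_zero h.antitone h.nonneg ?_ i hi
  rw [h.esymmOn_eq (by omega), minorSum_indicatorVec,
    Finset.powersetCard_eq_empty.2 (Nat.lt_succ_self _), Finset.sum_empty]

/-- The value of `Φ` at `∑ x_i h_i h_iᵀ`, as a function of `C = HᵀH`. -/
theorem exists_isSpectrum (H : Matrix (Fin n) (Fin n) ℝ) (x : Fin n → ℝ)
    (hY : (weightedSum H x).PosSemidef) (k : ℕ) :
    ∃ β : Fin n → ℝ, IsSpectrum (Hᵀ * H) x β ∧ Phi k (weightedSum H x) hY = phi k β := by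
  have key : ∀ m (hm : m = n) (γ : Fin m → ℝ), IsSpectrum (Hᵀ * H) x γ →
      ∃ β : Fin n → ℝ, IsSpectrum (Hᵀ * H) x β ∧ phi k γ = phi k β := by
    rintro m rfl γ hγ
    exact ⟨γ, hγ, rfl⟩
  exact key _ (Fintype.card_fin n) _ (isSpectrum_eigenvalues₀ H x hY)

theorem Phi_weightedSum {H : Matrix (Fin n) (Fin n) ℝ} {x : Fin n → ℝ}
    (hY : (weightedSum H x).PosSemidef) (k : ℕ) {β : Fin n → ℝ}
    (hβ : IsSpectrum (Hᵀ * H) x β) : Phi k (weightedSum H x) hY = phi k β := by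
  obtain ⟨γ, hγ, h⟩ := exists_isSpectrum H x hY k
  rw [h, hγ.eq hβ]

end Spectrum

/-! ### Attainment of both minima -/

section Attainment

variable {n : ℕ}

/-- Evaluating the polynomial identity at every real `t` turns being a spectrum into closed
conditions on `(x, β)`. -/
theorem isSpectrum_iff (C : Matrix (Fin n) (Fin n) ℝ) (x β : Fin n → ℝ) :
    IsSpectrum C x β ↔ (∀ i j, i ≤ j → β j ≤ β i) ∧ (∀ i, 0 ≤ β i) ∧
      ∀ t : ℝ, ∏ i, (t - β i) = (scalar (Fin n) t - diagonal x * C).det := by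
  have h : ∀ t : ℝ, (∏ i, (Polynomial.X - Polynomial.C (β i))).eval t = ∏ i, (t - β i) := by
    intro t
    simp [Polynomial.eval_prod]
  refine ⟨fun hs => ⟨fun i j hij => hs.antitone hij, hs.nonneg, fun t => ?_⟩,
    fun hs => ⟨fun i j hij => hs.1 i j hij, hs.2.1, Polynomial.funext fun t => ?_⟩⟩
  · rw [← h, hs.prod_eq, eval_charpoly]
  · rw [h, hs.2.2, eval_charpoly]

/-- Feasible points of the relaxation together with the corresponding spectra. -/
def feasibleSpectra (C : Matrix (Fin n) (Fin n) ℝ) (k : ℕ) : Set ((Fin n → ℝ) × (Fin n → ℝ)) :=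
  {p | (∀ i, p.1 i ∈ Set.Icc (0 : ℝ) 1) ∧ ∑ i, p.1 i = k ∧ IsSpectrum C p.1 p.2}

theorem IsSpectrum.le_sum_minors {C : Matrix (Fin n) (Fin n) ℝ} (hC : C.PosDef) {x β : Fin n → ℝ}
    (hx : ∀ i, x i ∈ Set.Icc (0 : ℝ) 1) (h : IsSpectrum C x β) (i : Fin n) :
    β i ≤ ∑ S ∈ Finset.univ.powersetCard 1, principalMinor C S := by
  have h1 := h.esymmOn_eq (j := 1) (by have := i.2; omega)
  have h2 : β i ≤ esymmOn Finset.univ β 1 := by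
    rw [esymmOn, Finset.powersetCard_one, Finset.sum_map]
    simpa using Finset.single_le_sum (fun j _ => h.nonneg j) (Finset.mem_univ i)
  rw [h1] at h2
  refine h2.trans (Finset.sum_le_sum fun S _ => ?_)
  exact mul_le_of_le_one_left (principalMinor_pos hC S).le
    (Finset.prod_le_one (fun j _ => (hx j).1) fun j _ => (hx j).2)

theorem isCompact_feasibleSpectra {C : Matrix (Fin n) (Fin n) ℝ} (hC : C.PosDef) (k : ℕ) :
    IsCompact (feasibleSpectra C k) := by
  set B := ∑ S ∈ Finset.univ.powersetCard 1, principalMinor C S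
  have hK : IsCompact (Set.pi Set.univ (fun _ : Fin n => Set.Icc (0 : ℝ) 1) ×ˢ
      Set.pi Set.univ (fun _ : Fin n => Set.Icc (0 : ℝ) B)) :=
    (isCompact_univ_pi fun _ => isCompact_Icc).prod (isCompact_univ_pi fun _ => isCompact_Icc)
  refine hK.of_isClosed_subset ?_ ?_
  · simp only [feasibleSpectra, isSpectrum_iff, Set.mem_Icc, Set.ofPred_and, Set.ofPred_forall]
    refine IsClosed.inter (isClosed_iInter fun i => IsClosed.inter ?_ ?_)
      (IsClosed.inter ?_ (IsClosed.inter (isClosed_iInter fun i => isClosed_iInter fun j =>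
        isClosed_iInter fun _ => ?_) (IsClosed.inter (isClosed_iInter fun i => ?_)
          (isClosed_iInter fun t => ?_))))
    · exact isClosed_le (by fun_prop) (by fun_prop)
    · exact isClosed_le (by fun_prop) (by fun_prop)
    · exact isClosed_eq (by fun_prop) (by fun_prop)
    · exact isClosed_le (by fun_prop) (by fun_prop)
    · exact isClosed_le (by fun_prop) (by fun_prop)
    · refine isClosed_eq (by fun_prop) (Continuous.matrix_det ?_)
      exact continuous_const.sub (continuous_fst.matrix_diagonal.matrix_mul continuous_const)
  · rintro ⟨x, β⟩ ⟨h1, -, h3⟩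
    exact ⟨fun i _ => h1 i, fun i _ => ⟨h3.nonneg i, h3.le_sum_minors hC h1 i⟩⟩

theorem continuous_tailSum (ι : ℕ) : Continuous (tailSum ι : (Fin n → ℝ) → ℝ) := by
  unfold tailSum
  fun_prop

/-- Working with pairs `(x, β)` avoids proving that eigenvalues depend continuously on `x`. The weak
split conditions cut the feasible pairs into compact pieces `K ι`, on which `φ` is the continuous
function `splitValue k ι`, its denominators being positive. -/
theorem isCompact_phi_image {C : Matrix (Fin n) (Fin n) ℝ} (hC : C.PosDef) {k : ℕ}
    (hk : 1 ≤ k) (hkn : k ≤ n) :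
    IsCompact ((fun p : (Fin n → ℝ) × (Fin n → ℝ) => phi k p.2) '' feasibleSpectra C k) := by
  have hpos : ∀ p ∈ feasibleSpectra C k, ∀ i : Fin n, (i : ℕ) < k → 0 < p.2 i :=
    fun p hp i hi => hp.2.2.pos hC hp.1 hp.2.1 hkn i hi
  let K : ℕ → Set ((Fin n → ℝ) × (Fin n → ℝ)) := fun ι =>
    feasibleSpectra C k ∩ {p | (∀ i : Fin n, (i : ℕ) + 1 = ι → tailSum ι p.2 / ((k : ℝ) - ι) ≤ p.2 i) ∧
      (∀ i : Fin n, (i : ℕ) = ι → p.2 i ≤ tailSum ι p.2 / ((k : ℝ) - ι))}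
  have htail : ∀ ι, Continuous fun p : (Fin n → ℝ) × (Fin n → ℝ) =>
      tailSum ι p.2 / ((k : ℝ) - ι) := fun ι =>
    ((continuous_tailSum ι).comp continuous_snd).div_const _
  have hKc : ∀ ι, IsCompact (K ι) := fun ι => by
    refine (isCompact_feasibleSpectra hC k).inter_right ?_
    simp only [Set.ofPred_and, Set.ofPred_forall]
    exact IsClosed.inter
      (isClosed_iInter fun i => isClosed_iInter fun _ => isClosed_le (htail ι) (by fun_prop))
      (isClosed_iInter fun i => isClosed_iInter fun _ => isClosed_le (by fun_prop) (htail ι))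
  have hunion : (fun p : (Fin n → ℝ) × (Fin n → ℝ) => phi k p.2) '' feasibleSpectra C k =
      ⋃ ι ∈ Finset.range k, (fun p : (Fin n → ℝ) × (Fin n → ℝ) => splitValue k ι p.2) '' K ι := by
    ext v
    simp only [Set.mem_image, Set.mem_iUnion, Finset.mem_range]
    constructor
    · rintro ⟨p, hp, rfl⟩
      have h := (isSplitIndex_splitIndex hk hkn hp.2.2.antitone
        hp.2.2.nonneg).isWeakSplitIndex
      exact ⟨splitIndex k p.2, h.1, p, ⟨hp, h.2⟩, (phi_eq_splitValue_splitIndex k p.2).symm⟩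
    · rintro ⟨ι, hι, p, ⟨hp, h⟩, rfl⟩
      exact ⟨p, hp, phi_eq_splitValue hk hkn hp.2.2.antitone hp.2.2.nonneg (hpos p hp) ⟨hι, h⟩⟩
  rw [hunion]
  refine (Finset.range k).isCompact_biUnion fun ι hι => (hKc ι).image_of_continuousOn ?_
  rw [Finset.mem_range] at hι
  unfold splitValue
  refine ContinuousOn.add (continuousOn_finsetSum _ fun i hi => ContinuousOn.div
    continuousOn_const (by fun_prop) fun p hp => ?_) (ContinuousOn.div continuousOn_const
      ((continuous_tailSum ι).comp continuous_snd).continuousOn fun p hp => ?_)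
  · simp only [Finset.mem_filter, Finset.mem_univ, true_and] at hi
    exact (hpos p hp.1 i (hi.trans hι)).ne'
  · exact (tailSum_pos hp.1.2.2.nonneg (hpos p hp.1) hι hkn).ne'

theorem mem_relaxationValues {d : ℕ} (a : Fin n → Fin d → ℝ) {lam : ℝ} (hlam : 0 < lam) (k : ℕ)
    (v : ℝ) : v ∈ relaxationValues a hlam k ↔
      ∃ x β : Fin n → ℝ, (∀ i, x i ∈ Set.Icc (0 : ℝ) 1) ∧ ∑ i, x i = (k : ℝ) ∧
        IsSpectrum (covMatrix a lam) x β ∧ v = phi k β + ((d : ℝ) - k) / lam := by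
  have hH := cholesky_transpose_mul_self (covMatrix_posDef a hlam)
  constructor
  · rintro ⟨x, hx, hs, rfl⟩
    obtain ⟨β, hβ, h⟩ := exists_isSpectrum _ x (weightedSum_posSemidef _ hx) k
    rw [hH] at hβ
    exact ⟨x, β, hx, hs, hβ, by rw [h]⟩
  · rintro ⟨x, β, hx, hs, hβ, rfl⟩
    rw [← hH] at hβ
    exact ⟨x, hx, hs, by rw [Phi_weightedSum (weightedSum_posSemidef _ hx) k hβ]⟩

theorem exists_isSpectrum_covMatrix {d : ℕ} (a : Fin n → Fin d → ℝ) {lam : ℝ} (hlam : 0 < lam)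
    {x : Fin n → ℝ} (hx : ∀ i, x i ∈ Set.Icc (0 : ℝ) 1) :
    ∃ β : Fin n → ℝ, IsSpectrum (covMatrix a lam) x β := by
  obtain ⟨β, hβ, -⟩ := exists_isSpectrum (cholesky (covMatrix_posDef a hlam)) x
    (weightedSum_posSemidef _ hx) 0
  rw [cholesky_transpose_mul_self] at hβ
  exact ⟨β, hβ⟩

theorem isLeast_nuM {d : ℕ} (a : Fin n → Fin d → ℝ) {lam : ℝ} (hlam : 0 < lam) {k : ℕ}
    (hk : 1 ≤ k) (hkn : k ≤ n) : IsLeast (relaxationValues a hlam k) (nuM a hlam k) := by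
  have hset : relaxationValues a hlam k = (fun v => v + ((d : ℝ) - k) / lam) ''
      ((fun p : (Fin n → ℝ) × (Fin n → ℝ) => phi k p.2) ''
        feasibleSpectra (covMatrix a lam) k) := by
    ext v
    rw [mem_relaxationValues, Set.image_image]
    constructor
    · rintro ⟨x, β, hx, hs, hβ, rfl⟩
      exact ⟨(x, β), ⟨hx, hs, hβ⟩, rfl⟩
    · rintro ⟨⟨x, β⟩, ⟨hx, hs, hβ⟩, rfl⟩
      exact ⟨x, β, hx, hs, hβ, rfl⟩
  refine IsCompact.isLeast_sInf ?_ ?_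
  · rw [hset]
    exact (isCompact_phi_image (covMatrix_posDef a hlam) hk hkn).image (by fun_prop)
  · obtain ⟨S, -, hS⟩ := Finset.exists_subset_card_eq
      (show k ≤ (Finset.univ : Finset (Fin n)).card by simpa using hkn)
    obtain ⟨β, hβ⟩ := exists_isSpectrum_covMatrix a hlam (indicatorVec_mem S)
    exact ⟨_, (mem_relaxationValues a hlam k _).2
      ⟨_, β, indicatorVec_mem S, by rw [sum_indicatorVec, hS], hβ, rfl⟩⟩

theorem isLeast_z {d : ℕ} (a : Fin n → Fin d → ℝ) (lam : ℝ) {k : ℕ} (hkn : k ≤ n) :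
    IsLeast (designValues a lam k) (z a lam k) := by
  have hset : designValues a lam k =
      objective a lam '' ((Finset.univ : Finset (Fin n)).powersetCard k : Set (Finset (Fin n))) := by
    ext v
    simp only [designValues, Set.mem_ofPred_eq, Set.mem_image, Finset.mem_coe,
      Finset.mem_powersetCard, Finset.subset_univ, true_and]
    exact exists_congr fun S => and_congr_right fun _ => eq_comm
  rw [z, hset]
  refine (Finset.finite_toSet _).image _ |>.isCompact.isLeast_sInf ?_
  refine Set.Nonempty.image _ ?_
  rw [Finset.coe_nonempty, Finset.powersetCard_nonempty]
  simpa using hkn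

end Attainment

/-! ### The objective at a subset as a value of `φ` -/

section Objective

variable {d n : ℕ}

theorem sum_vecMulVec_eq (a : Fin n → Fin d → ℝ) (S : Finset (Fin n)) :
    ∑ i ∈ S, vecMulVec (a i) (a i) =
      designMatrix a * diagonal (indicatorVec S) * (designMatrix a)ᵀ := by
  ext i j
  rw [Matrix.sum_apply, Matrix.mul_apply, ← Finset.sum_subset (Finset.subset_univ S)]
  · refine Finset.sum_congr rfl fun l hl => ?_
    simp [mul_diagonal, indicatorVec, hl, vecMulVec_apply, designMatrix]
  · intro l _ hl
    simp [mul_diagonal, indicatorVec, hl]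

theorem posSemidef_sum_vecMulVec (a : Fin n → Fin d → ℝ) (S : Finset (Fin n)) :
    (∑ i ∈ S, vecMulVec (a i) (a i)).PosSemidef :=
  Matrix.posSemidef_sum _ fun i _ => by simpa using Matrix.posSemidef_vecMulVec_self_star (a i)

theorem _root_.Matrix.PosSemidef.trace_inv_add_smul_one {P : Matrix (Fin d) (Fin d) ℝ}
    (hP : P.PosSemidef) {lam : ℝ} (hlam : 0 < lam) :
    (P + lam • (1 : Matrix (Fin d) (Fin d) ℝ))⁻¹.trace =
      ∑ i, (hP.isHermitian.eigenvalues i + lam)⁻¹ := by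
  set p := hP.isHermitian.eigenvalues with hp
  let U : Matrix (Fin d) (Fin d) ℝ := ↑hP.isHermitian.eigenvectorUnitary
  have hUU : U * star U = 1 := Unitary.coe_mul_star_self hP.isHermitian.eigenvectorUnitary
  have hUU' : star U * U = 1 := Unitary.coe_star_mul_self hP.isHermitian.eigenvectorUnitary
  have hspec : P = U * diagonal p * star U := by
    have := hP.isHermitian.spectral_theorem
    rw [Unitary.conjStarAlgAut_apply] at this
    exact this
  have hpl : ∀ i, p i + lam ≠ 0 := fun i => by
    have := hP.eigenvalues_nonneg i
    positivity
  have hB : P + lam • (1 : Matrix (Fin d) (Fin d) ℝ) =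
      U * diagonal (fun i => p i + lam) * star U := by
    have h1 : diagonal (fun i => p i + lam) =
        diagonal p + lam • (1 : Matrix (Fin d) (Fin d) ℝ) := by
      rw [smul_one_eq_diagonal, diagonal_add]
    rw [h1, Matrix.mul_add, Matrix.add_mul, ← hspec, Matrix.mul_smul, Matrix.mul_one,
      Matrix.smul_mul, hUU]
  have hinv : (P + lam • (1 : Matrix (Fin d) (Fin d) ℝ))⁻¹ =
      U * diagonal (fun i => (p i + lam)⁻¹) * star U := by
    refine Matrix.inv_eq_right_inv ?_
    rw [hB]
    calc U * diagonal (fun i => p i + lam) * star U *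
          (U * diagonal (fun i => (p i + lam)⁻¹) * star U)
        = U * diagonal (fun i => p i + lam) * (star U * U) *
          diagonal (fun i => (p i + lam)⁻¹) * star U := by simp only [Matrix.mul_assoc]
      _ = U * (diagonal (fun i => p i + lam) * diagonal (fun i => (p i + lam)⁻¹)) * star U := by
          rw [hUU', Matrix.mul_one, Matrix.mul_assoc U]
      _ = 1 := by
          rw [diagonal_mul_diagonal]
          simp only [mul_inv_cancel₀ (hpl _), diagonal_one, Matrix.mul_one, hUU]
  rw [hinv, Matrix.trace_mul_comm, ← Matrix.mul_assoc, hUU', Matrix.one_mul, trace_diagonal]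

theorem objective_le (a : Fin n → Fin d → ℝ) {lam : ℝ} (hlam : 0 < lam) (S : Finset (Fin n)) :
    objective a lam S ≤ d / lam := by
  have hP := posSemidef_sum_vecMulVec a S
  rw [objective, hP.trace_inv_add_smul_one hlam]
  calc ∑ i, (hP.isHermitian.eigenvalues i + lam)⁻¹ ≤ ∑ _i : Fin d, lam⁻¹ :=
        Finset.sum_le_sum fun i _ => inv_anti₀ hlam (by linarith [hP.eigenvalues_nonneg i])
    _ = d / lam := by simp [div_eq_mul_inv]

/-- Factor `tI - D C = diag(q)(1 - (t-λ)⁻¹ D Aᵀ A)`, with `q = t - λ` on `S` and `q = t` off `S`,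
then apply `det(1 - XY) = det(1 - YX)`. The power `(t-λ)^d` clears the denominators. -/
theorem det_scalar_sub_diagonal_mul_covMatrix (a : Fin n → Fin d → ℝ) {lam t : ℝ}
    (htl : t ≠ lam) (S : Finset (Fin n)) :
    (scalar (Fin n) t - diagonal (indicatorVec S) * covMatrix a lam).det * (t - lam) ^ d =
      (scalar (Fin d) (t - lam) - ∑ i ∈ S, vecMulVec (a i) (a i)).det *
        ((t - lam) ^ S.card * t ^ (n - S.card)) := by
  set A := designMatrix a
  set D : Matrix (Fin n) (Fin n) ℝ := diagonal (indicatorVec S) with hD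
  have hs : t - lam ≠ 0 := sub_ne_zero.2 htl
  let q : Fin n → ℝ := fun i => if i ∈ S then t - lam else t
  have h1 : scalar (Fin n) t - D * covMatrix a lam =
      diagonal q * (1 - ((t - lam)⁻¹ • (D * Aᵀ)) * A) := by
    have h2 : diagonal q = scalar (Fin n) t - lam • D := by
      rw [hD, scalar_apply, ← diagonal_smul, diagonal_sub]
      congr 1
      funext i
      simp only [q, indicatorVec, Pi.smul_apply, smul_eq_mul]
      split_ifs <;> simp
    have h3 : diagonal q * ((t - lam)⁻¹ • D) = D := by
      rw [hD, ← diagonal_smul, diagonal_mul_diagonal]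
      congr 1
      funext i
      simp only [q, indicatorVec, Pi.smul_apply, smul_eq_mul]
      split_ifs
      · field_simp
      · simp
    rw [Matrix.mul_sub, Matrix.mul_one, ← Matrix.smul_mul, Matrix.mul_assoc, ← Matrix.mul_assoc,
      h3, h2, covMatrix, Matrix.mul_add, Matrix.mul_smul, Matrix.mul_one]
    abel
  have h4 : (diagonal q).det = (t - lam) ^ S.card * t ^ (n - S.card) := by
    rw [det_diagonal, Finset.prod_ite, Finset.prod_const, Finset.prod_const]
    congr 2
    · simp
    · rw [Finset.filter_not, Finset.card_sdiff_of_subset (Finset.filter_subset _ _)]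
      simp
  have h5 : (1 - A * ((t - lam)⁻¹ • (D * Aᵀ))).det * (t - lam) ^ d =
      (scalar (Fin d) (t - lam) - A * D * Aᵀ).det := by
    have h6 : scalar (Fin d) (t - lam) - A * D * Aᵀ =
        (t - lam) • (1 - A * ((t - lam)⁻¹ • (D * Aᵀ))) := by
      rw [smul_sub, Matrix.mul_smul, smul_inv_smul₀ hs, Matrix.mul_assoc, scalar_apply,
        smul_one_eq_diagonal]
    rw [h6, det_smul, Fintype.card_fin, mul_comm]
  rw [h1, det_mul, det_one_sub_mul_comm, h4, sum_vecMulVec_eq, ← h5]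
  ring

theorem IsSpectrum.prod_indicatorVec {a : Fin n → Fin d → ℝ} {lam : ℝ} {S : Finset (Fin n)}
    {β : Fin n → ℝ} (h : IsSpectrum (covMatrix a lam) (indicatorVec S) β) :
    (∏ i, (Polynomial.X - Polynomial.C (β i))) * (Polynomial.X - Polynomial.C lam) ^ d =
      (∏ i, (Polynomial.X - Polynomial.C
        ((posSemidef_sum_vecMulVec a S).isHermitian.eigenvalues i + lam))) *
        ((Polynomial.X - Polynomial.C lam) ^ S.card * Polynomial.X ^ (n - S.card)) := by
  set hP := posSemidef_sum_vecMulVec a S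
  -- The determinant identity excludes `t = λ`; the remaining infinitely many points suffice.
  refine Polynomial.eq_of_infinite_eval_eq _ _
    ((Set.Finite.infinite_compl (Set.finite_singleton lam)).mono fun t ht => ?_)
  have h1 := det_scalar_sub_diagonal_mul_covMatrix a (t := t) ht S
  rw [← eval_charpoly, ← eval_charpoly, ← h.prod_eq, hP.isHermitian.charpoly_eq] at h1
  simp only [Set.mem_ofPred_eq, Polynomial.eval_mul, Polynomial.eval_pow, Polynomial.eval_sub,
    Polynomial.eval_X, Polynomial.eval_C, Polynomial.eval_prod] at h1 ⊢
  rw [h1]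
  congr 1
  refine Finset.prod_congr rfl fun i _ => ?_
  simp only [RCLike.ofReal_real_eq_id, id_eq]
  ring

theorem IsSpectrum.sum_inv_add {a : Fin n → Fin d → ℝ} {lam : ℝ} {S : Finset (Fin n)}
    {β : Fin n → ℝ} (h : IsSpectrum (covMatrix a lam) (indicatorVec S) β) :
    ∑ i, (β i)⁻¹ + d * lam⁻¹ =
      ∑ i, ((posSemidef_sum_vecMulVec a S).isHermitian.eigenvalues i + lam)⁻¹ +
        S.card * lam⁻¹ := by
  have hp : ∀ {m : ℕ} (δ : Fin m → ℝ), (∏ i, (Polynomial.X - Polynomial.C (δ i))) ≠ 0 := fun δ =>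
    Finset.prod_ne_zero_iff.2 fun i _ => Polynomial.X_sub_C_ne_zero _
  have hl : ∀ j : ℕ, (Polynomial.X - Polynomial.C lam) ^ j ≠ 0 := fun j =>
    pow_ne_zero _ (Polynomial.X_sub_C_ne_zero _)
  have hroots : ∀ {m : ℕ} (δ : Fin m → ℝ), (∏ i, (Polynomial.X - Polynomial.C (δ i))).roots =
      Finset.univ.val.map δ := fun δ => by
    rw [Polynomial.roots_prod _ _ (hp δ)]
    simp
  -- Sum the reciprocals of the roots with multiplicity. Since `0⁻¹ = 0`, the factor `X^(n-|S|)` and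
  -- the zero eigenvalues contribute nothing.
  have h1 := congrArg (fun f : Polynomial ℝ => (f.roots.map fun t => t⁻¹).sum)
    h.prod_indicatorVec
  rw [Polynomial.roots_mul (mul_ne_zero (hp _) (hl _)),
    Polynomial.roots_mul (mul_ne_zero (hp _) (mul_ne_zero (hl _) (pow_ne_zero _ Polynomial.X_ne_zero))),
    Polynomial.roots_mul (mul_ne_zero (hl _) (pow_ne_zero _ Polynomial.X_ne_zero)),
    hroots, hroots, Polynomial.roots_pow, Polynomial.roots_pow, Polynomial.roots_pow,
    Polynomial.roots_X_sub_C, Polynomial.roots_X] at h1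
  simpa [Multiset.map_add, Multiset.map_nsmul, Multiset.sum_nsmul, List.sum_ofFn] using h1

theorem objective_eq_phi_add {a : Fin n → Fin d → ℝ} {lam : ℝ} (hlam : 0 < lam)
    {S : Finset (Fin n)} {k : ℕ} (hS : S.card = k) (hk : 1 ≤ k) {β : Fin n → ℝ}
    (h : IsSpectrum (covMatrix a lam) (indicatorVec S) β) :
    objective a lam S = phi k β + ((d : ℝ) - k) / lam := by
  have hkn : k ≤ n := by simpa [hS] using S.card_le_univ
  have h1 := h.sum_inv_add
  rw [objective, (posSemidef_sum_vecMulVec a S).trace_inv_add_smul_one hlam,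
    phi_eq_sum_inv hk hkn h.antitone h.nonneg (fun i hi => h.pos (covMatrix_posDef a hlam)
      (indicatorVec_mem S) (by rw [sum_indicatorVec, hS]) hkn i hi)
      (fun i hi => h.eq_zero i (hS ▸ hi)), sub_div, div_eq_mul_inv, div_eq_mul_inv]
  rw [hS] at h1
  linarith

end Objective

/-! ### Averaging over random subsets -/

section Sampling

variable {n : ℕ}

/-- After the exchange, `x^T det C_{T,T}` carries `∑_{i ∉ T} x_i`, bounded by the full sum `r + 1`
and by its number of terms `n - r`. -/
theorem sum_prod_mul_sum_principalMinor_le {C : Matrix (Fin n) (Fin n) ℝ} (hC : C.PosDef)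
    {x : Fin n → ℝ} (hx : ∀ i, x i ∈ Set.Icc (0 : ℝ) 1) {r : ℕ} (hsum : ∑ i, x i = (r + 1 : ℕ)) :
    ∑ S ∈ Finset.univ.powersetCard (r + 1), (∏ i ∈ S, x i) *
        ∑ T ∈ S.powersetCard r, principalMinor C T ≤
      min ((r + 1 : ℕ) : ℝ) ((n : ℝ) - (r + 1 : ℕ) + 1) * minorSum C x r := by
  have h1 : ∑ S ∈ Finset.univ.powersetCard (r + 1), (∏ i ∈ S, x i) *
        ∑ T ∈ S.powersetCard r, principalMinor C T =
      ∑ T ∈ Finset.univ.powersetCard r, ∑ i ∈ Finset.univ \ T,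
        x i * ((∏ j ∈ T, x j) * principalMinor C T) := by
    rw [sum_powersetCard_sum_sdiff Finset.univ r
      fun T i => x i * ((∏ j ∈ T, x j) * principalMinor C T)]
    refine Finset.sum_congr rfl fun S hS => ?_
    rw [sum_powersetCard_pred (Finset.mem_powersetCard.1 hS).2, Finset.mul_sum]
    refine Finset.sum_congr rfl fun i hi => ?_
    rw [← Finset.mul_prod_erase S x hi, mul_assoc]
  rw [h1, minorSum, Finset.mul_sum]
  refine Finset.sum_le_sum fun T hT => ?_
  rw [← Finset.sum_mul]
  refine mul_le_mul_of_nonneg_right (le_min ?_ ?_)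
    (mul_nonneg (Finset.prod_nonneg fun i _ => (hx i).1) (principalMinor_pos hC T).le)
  · rw [← hsum]
    exact Finset.sum_le_sum_of_subset_of_nonneg (Finset.sdiff_subset) fun i _ _ => (hx i).1
  · refine (Finset.sum_le_sum fun i _ => (hx i).2).trans ?_
    have h2 := (Finset.mem_powersetCard.1 hT).2
    have h3 : r ≤ n := by simpa [h2] using T.card_le_univ
    rw [Finset.sum_const, Finset.card_sdiff_of_subset (Finset.subset_univ T), h2]
    simp [Nat.cast_sub h3]
    linarith

/-- Some `S` with `|S| = k` is at least as good as the average of the distribution with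
probabilities proportional to `x^S det C_{S,S}`. -/
theorem exists_phi_indicatorVec_le {C : Matrix (Fin n) (Fin n) ℝ} (hC : C.PosDef)
    {x : Fin n → ℝ} (hx : ∀ i, x i ∈ Set.Icc (0 : ℝ) 1) {k : ℕ} (hk : 1 ≤ k) (hkn : k ≤ n)
    (hsum : ∑ i, x i = (k : ℝ)) {β : Fin n → ℝ} (hβ : IsSpectrum C x β) :
    ∃ S : Finset (Fin n), S.card = k ∧ ∀ γ : Fin n → ℝ, IsSpectrum C (indicatorVec S) γ →
      phi k γ ≤ min (k : ℝ) ((n : ℝ) - k + 1) * phi k β := by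
  obtain ⟨r, rfl⟩ : ∃ r, k = r + 1 := ⟨k - 1, by omega⟩
  have hkR : ((r + 1 : ℕ) : ℝ) ≤ n := by exact_mod_cast hkn
  set M := min ((r + 1 : ℕ) : ℝ) ((n : ℝ) - (r + 1 : ℕ) + 1) with hM
  have hM0 : 0 ≤ M := le_min (Nat.cast_nonneg _) (by linarith)
  have hphi := esymmOn_pred_le_phi_mul hk hkn hβ.antitone hβ.nonneg
    (fun i hi => hβ.pos hC hx hsum hkn i hi)
  rw [Nat.add_sub_cancel, hβ.esymmOn_eq (by omega), hβ.esymmOn_eq hkn] at hphi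
  have havg := (sum_prod_mul_sum_principalMinor_le hC hx hsum).trans
    (mul_le_mul_of_nonneg_left hphi hM0)
  by_contra! hcon
  refine absurd havg (not_le.2 ?_)
  rw [minorSum, ← mul_assoc, Finset.mul_sum]
  have hstep : ∀ S : Finset (Fin n), S.card = r + 1 → M * phi (r + 1) β * principalMinor C S <
      ∑ T ∈ S.powersetCard r, principalMinor C T := by
    intro S hS
    obtain ⟨γ, hγ, hlt⟩ := hcon S hS
    have h1 := phi_mul_esymmOn hk hkn hγ.antitone hγ.nonneg (fun i hi => hγ.pos hC
      (indicatorVec_mem S) (by rw [sum_indicatorVec, hS]) hkn i hi)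
      (fun i hi => hγ.eq_zero i (hS ▸ hi))
    rw [Nat.add_sub_cancel, hγ.esymmOn_eq hkn, hγ.esymmOn_eq (by omega), minorSum_indicatorVec,
      minorSum_indicatorVec] at h1
    have hps := Finset.powersetCard_self S
    rw [hS] at hps
    rw [hps, Finset.sum_singleton] at h1
    rw [← h1]
    exact mul_lt_mul_of_pos_right hlt (principalMinor_pos hC S)
  -- If every `S` were worse than claimed, so would be the average; strictness needs one `S` of
  -- positive weight, found inside the support of `x`.
  obtain ⟨S, hS, hcard⟩ := Finset.exists_subset_card_eq (le_card_support hx hsum)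
  refine Finset.sum_lt_sum (fun T hT => ?_) ⟨S, by simp [hcard], ?_⟩
  · rw [mul_left_comm]
    exact mul_le_mul_of_nonneg_left (hstep T (Finset.mem_powersetCard.1 hT).2).le
      (Finset.prod_nonneg fun i _ => (hx i).1)
  · rw [mul_left_comm]
    exact mul_lt_mul_of_pos_left (hstep S hcard)
      (Finset.prod_pos fun i hi => (Finset.mem_filter.1 (hS hi)).2)

end Sampling

/-! ### The approximation ratios -/

section Bounds

variable {d n k : ℕ}

theorem nuM_le_z (a : Fin n → Fin d → ℝ) {lam : ℝ} (hlam : 0 < lam) (hk : 1 ≤ k) (hkn : k ≤ n) :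
    nuM a hlam k ≤ z a lam k := by
  obtain ⟨S, hS, hz⟩ := (isLeast_z a lam hkn).1
  obtain ⟨β, hβ⟩ := exists_isSpectrum_covMatrix a hlam (indicatorVec_mem S)
  refine (isLeast_nuM a hlam hk hkn).2 ((mem_relaxationValues a hlam k _).2
    ⟨_, β, indicatorVec_mem S, by rw [sum_indicatorVec, hS], hβ, ?_⟩)
  rw [hz, objective_eq_phi_add hlam hS hk hβ]

theorem exists_nuM_eq_and_z_le (a : Fin n → Fin d → ℝ) {lam : ℝ} (hlam : 0 < lam) (hk : 1 ≤ k)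
    (hkn : k ≤ n) : ∃ p : ℝ, 0 < p ∧ nuM a hlam k = p + ((d : ℝ) - k) / lam ∧
      z a lam k ≤ min (k : ℝ) ((n : ℝ) - k + 1) * p + ((d : ℝ) - k) / lam ∧
      z a lam k ≤ d / lam := by
  have hC := covMatrix_posDef a hlam
  obtain ⟨x, β, hx, hsum, hβ, hν⟩ := (mem_relaxationValues a hlam k _).1
    (isLeast_nuM a hlam hk hkn).1
  obtain ⟨S, hS, hle⟩ := exists_phi_indicatorVec_le hC hx hk hkn hsum hβ
  obtain ⟨γ, hγ⟩ := exists_isSpectrum_covMatrix a hlam (indicatorVec_mem S)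
  have hz : z a lam k ≤ objective a lam S := (isLeast_z a lam hkn).2 ⟨S, hS, rfl⟩
  refine ⟨phi k β, phi_pos hk hkn hβ.antitone hβ.nonneg
    fun i hi => hβ.pos hC hx hsum hkn i hi, hν, ?_, hz.trans (objective_le a hlam S)⟩
  rw [objective_eq_phi_add hlam hS hk hγ] at hz
  exact hz.trans (by linarith [hle γ hγ])

theorem one_le_z_div_nuM (a : Fin n → Fin d → ℝ) {lam : ℝ} (hlam : 0 < lam) (hk : 1 ≤ k)
    (hkn : k ≤ n) (hkd : k ≤ d) : 1 ≤ z a lam k / nuM a hlam k := by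
  obtain ⟨p, hp, hν, -⟩ := exists_nuM_eq_and_z_le a hlam hk hkn
  have hkd' : (0 : ℝ) ≤ (d : ℝ) - k := sub_nonneg.2 (by exact_mod_cast hkd)
  have hpos : 0 < nuM a hlam k := by rw [hν]; positivity
  rw [one_le_div hpos]
  exact nuM_le_z a hlam hk hkn

theorem z_div_nuM_le_of_eq (a : Fin n → Fin d → ℝ) {lam : ℝ} (hlam : 0 < lam) (hd : 1 ≤ d)
    (hdn : d ≤ n) : z a lam d / nuM a hlam d ≤ min (d : ℝ) ((n : ℝ) - d + 1) := by
  obtain ⟨p, hp, hν, hz, -⟩ := exists_nuM_eq_and_z_le a hlam hd hdn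
  simp only [sub_self, zero_div, add_zero] at hν hz
  rw [hν, div_le_iff₀ hp]
  exact hz

theorem z_div_nuM_le_of_lt (a : Fin n → Fin d → ℝ) {lam : ℝ} (hlam : 0 < lam) (hk : 1 ≤ k)
    (hkd : k < d) (hdn : d ≤ n) : z a lam k / nuM a hlam k ≤
      min (((d : ℝ) - 1) / ((d : ℝ) - k)) ((n : ℝ) - k + 1) := by
  have hkn : k ≤ n := hkd.le.trans hdn
  obtain ⟨p, hp, hν, hz1, hz2⟩ := exists_nuM_eq_and_z_le a hlam hk hkn
  have hk1 : (1 : ℝ) ≤ k := by exact_mod_cast hk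
  have hdk : (0 : ℝ) < (d : ℝ) - k := sub_pos.2 (by exact_mod_cast hkd)
  have hknR : (k : ℝ) ≤ n := by exact_mod_cast hkn
  have hq : 0 < lam⁻¹ := inv_pos.2 hlam
  rw [div_eq_mul_inv] at hν hz1 hz2
  have hpos : 0 < nuM a hlam k := by rw [hν]; positivity
  refine le_min ?_ ?_
  · rw [div_le_div_iff₀ hpos hdk, hν]
    have hz3 : z a lam k ≤ k * p + ((d : ℝ) - k) * lam⁻¹ :=
      hz1.trans (by gcongr; exact min_le_left _ _)
    -- Write `q = 1/λ`. The bound `d q` on `z` is used for `q ≤ p` and `k p + (d-k) q` for `p ≤ q`;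
    -- over `ν = p + (d-k) q` both ratios are largest at `p = q`, with value `d/(d-k+1) ≤
    -- (d-1)/(d-k)`.
    rcases le_total lam⁻¹ p with h | h
    · nlinarith [mul_le_mul_of_nonneg_right hz2 hdk.le,
        mul_nonneg (sub_nonneg.2 h) (by linarith : (0 : ℝ) ≤ (d : ℝ) - 1),
        mul_nonneg hq.le (sub_nonneg.2 hk1)]
    · nlinarith [mul_le_mul_of_nonneg_right hz3 hdk.le,
        mul_nonneg (mul_nonneg (sub_nonneg.2 h) hdk.le) (sub_nonneg.2 hk1),
        mul_nonneg hp.le (sub_nonneg.2 hk1)]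
  · rw [div_le_iff₀ hpos, hν]
    have hz3 : z a lam k ≤ ((n : ℝ) - k + 1) * p + ((d : ℝ) - k) * lam⁻¹ :=
      hz1.trans (by gcongr; exact min_le_right _ _)
    nlinarith [mul_nonneg (sub_nonneg.2 hknR) (mul_pos hdk hq).le]

end Bounds

/-! ### Negative relaxation values for `k > d` -/

section Negative

variable {d n k : ℕ}

/-- The first `d` vectors are `n` times the standard basis vectors, the others vanish. -/
def scaledBasis (d n : ℕ) (i : Fin n) (l : Fin d) : ℝ := if (i : ℕ) = l then (n : ℝ) else 0

theorem covMatrix_scaledBasis (d n : ℕ) : covMatrix (scaledBasis d n) 1 =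
    diagonal fun i : Fin n => if (i : ℕ) < d then (n : ℝ) ^ 2 + 1 else 1 := by
  have h : (designMatrix (scaledBasis d n))ᵀ * designMatrix (scaledBasis d n) =
      diagonal fun i : Fin n => if (i : ℕ) < d then (n : ℝ) ^ 2 else 0 := by
    ext i j
    simp only [mul_apply, transpose_apply, designMatrix, of_apply, scaledBasis, diagonal_apply]
    split_ifs with hij hi
    · subst hij
      rw [Finset.sum_eq_single ⟨i, hi⟩]
      · simp [sq]
      · intro l _ hl
        rw [if_neg fun h => hl (Fin.ext h.symm), zero_mul]
      · simp
    · refine Finset.sum_eq_zero fun l _ => ?_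
      rw [if_neg (c := (i : ℕ) = l) fun h => hi (h.trans_lt l.2), zero_mul]
    · refine Finset.sum_eq_zero fun l _ => ?_
      by_cases hi : (i : ℕ) = l
      · rw [if_neg (c := (j : ℕ) = l) fun h => hij (Fin.ext (hi.trans h.symm)), mul_zero]
      · rw [if_neg hi, zero_mul]
  rw [covMatrix, h, one_smul, ← diagonal_one, diagonal_add]
  congr 1
  funext i
  split_ifs <;> simp

/-- At `x_i = k/n` and `λ = 1` the split index is `d`. The tail part of `φ` plus `d - k` equals
`-d(k-d)(n-k)/(k(n-d))`, while the `d` large eigenvalues contribute less than `d/(kn)`, which is too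
small to compensate. -/
theorem nuM_scaledBasis_neg (hd : 1 ≤ d) (hdk : d + 1 ≤ k) (hkn : k < n) :
    nuM (scaledBasis d n) one_pos k < 0 := by
  have hn : (0 : ℝ) < n := by exact_mod_cast (by omega : 0 < n)
  have hn1 : (1 : ℝ) ≤ n := by exact_mod_cast (by omega : 1 ≤ n)
  have hk : (0 : ℝ) < k := by exact_mod_cast (by omega : 0 < k)
  have hdR : (1 : ℝ) ≤ d := by exact_mod_cast hd
  have hdkR : (d : ℝ) + 1 ≤ k := by exact_mod_cast hdk
  have hknR : (k : ℝ) + 1 ≤ n := by exact_mod_cast hkn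
  have hkd : (0 : ℝ) < (k : ℝ) - d := by linarith
  have hnd : (0 : ℝ) < (n : ℝ) - d := by linarith
  let x : Fin n → ℝ := fun _ => k / n
  let β : Fin n → ℝ := fun i => k / n * if (i : ℕ) < d then (n : ℝ) ^ 2 + 1 else 1
  have hx : ∀ i, x i ∈ Set.Icc (0 : ℝ) 1 := fun i =>
    ⟨by positivity, (div_le_one hn).2 (by linarith)⟩
  have hsum : ∑ i, x i = k := by simp [x]; field_simp
  have hβ : IsSpectrum (covMatrix (scaledBasis d n) 1) x β := by
    refine ⟨fun i j hij => mul_le_mul_of_nonneg_left ?_ (by positivity), fun i => ?_, ?_⟩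
    · have hij' : (i : ℕ) ≤ j := hij
      split_ifs
      · exact le_rfl
      · omega
      · nlinarith
      · exact le_rfl
    · simp only [β]
      split_ifs <;> positivity
    · rw [covMatrix_scaledBasis, diagonal_mul_diagonal, charpoly_diagonal]
  have htail : tailSum d β = k / n * (n - d) := by
    have h1 : ∀ j ∈ Finset.univ.filter (fun j : Fin n => d ≤ (j : ℕ)), β j = k / n := by
      intro j hj
      simp only [Finset.mem_filter, Finset.mem_univ, true_and] at hj
      simp [β, not_lt.2 hj]
    have h2 : (Finset.univ.filter (fun j : Fin n => d ≤ (j : ℕ))).card = n - d := by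
      have h3 := Finset.card_filter_add_card_filter_not (s := (Finset.univ : Finset (Fin n)))
        (fun j : Fin n => (j : ℕ) < d)
      simp only [not_lt, Fin.card_filter_val_lt, Finset.card_univ, Fintype.card_fin] at h3
      omega
    rw [tailSum, Finset.sum_congr rfl h1, Finset.sum_const, h2, nsmul_eq_mul,
      Nat.cast_sub (by omega)]
    ring
  have hphi : phi k β = splitValue k d β := by
    refine phi_eq_splitValue (by omega) hkn.le hβ.antitone hβ.nonneg
      (fun i hi => hβ.pos (covMatrix_posDef _ one_pos) hx hsum hkn.le i hi)
      ⟨by omega, fun i hi => ?_, fun i hi => ?_⟩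
    · have hid : (i : ℕ) < d := by omega
      rw [htail, div_le_iff₀ hkd]
      simp only [β, if_pos hid]
      rw [mul_assoc]
      gcongr
      nlinarith
    · have hid : ¬ (i : ℕ) < d := by omega
      rw [htail, le_div_iff₀ hkd]
      simp only [β, if_neg hid, mul_one]
      gcongr
  have hhead : ∑ i ∈ Finset.univ.filter (fun i : Fin n => (i : ℕ) < d), 1 / β i =
      d * (n / (k * ((n : ℝ) ^ 2 + 1))) := by
    have h1 : ∀ i ∈ Finset.univ.filter (fun i : Fin n => (i : ℕ) < d),
        1 / β i = n / (k * ((n : ℝ) ^ 2 + 1)) := by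
      intro i hi
      simp only [Finset.mem_filter, Finset.mem_univ, true_and] at hi
      simp only [β, if_pos hi]
      field_simp
    rw [Finset.sum_congr rfl h1, Finset.sum_const, Fin.card_filter_val_lt,
      min_eq_right (by omega), nsmul_eq_mul]
  refine lt_of_le_of_lt ((isLeast_nuM (scaledBasis d n) one_pos (by omega) hkn.le).2
    ((mem_relaxationValues _ one_pos k _).2 ⟨x, β, hx, hsum, hβ, rfl⟩)) ?_
  rw [hphi, splitValue, hhead, htail]
  have h1 : (d : ℝ) * (n / (k * ((n : ℝ) ^ 2 + 1))) < d / (k * n) := by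
    rw [← mul_div_assoc, div_lt_div_iff₀ (by positivity) (by positivity)]
    nlinarith [mul_pos (by linarith : (0 : ℝ) < d) hk]
  have h2 : ((k : ℝ) - d) ^ 2 / (k / n * (n - d)) + ((d : ℝ) - k) / 1 =
      -(d * (((k : ℝ) - d) * (n - k)) / (k * (n - d))) := by
    field_simp
    ring
  have h3 : (d : ℝ) / (k * n) ≤ d * (((k : ℝ) - d) * (n - k)) / (k * (n - d)) := by
    -- Both factors are at least `1` because `d < k < n` are integers.
    have h4 : (1 : ℝ) ≤ ((k : ℝ) - d) * (n - k) := by nlinarith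
    rw [div_le_div_iff₀ (by positivity) (by positivity)]
    have h5 : (n : ℝ) - d ≤ (((k : ℝ) - d) * (n - k)) * n := by nlinarith
    have h6 : (0 : ℝ) ≤ d * k := by positivity
    nlinarith [mul_le_mul_of_nonneg_left h5 h6]
  linarith

end Negative

end RAOD

theorem mainTheorem8 :
    -- both optimal values are attained minima
    (∀ (d n k : ℕ) (a : Fin n → Fin d → ℝ) (lam : ℝ) (hlam : 0 < lam),
      1 ≤ d → d ≤ n → 1 ≤ k → k ≤ n →
        IsLeast (RAOD.designValues a lam k) (RAOD.z a lam k) ∧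
        IsLeast (RAOD.relaxationValues a hlam k) (RAOD.nuM a hlam k)) ∧
    -- (i)
    (∀ (d n k : ℕ) (a : Fin n → Fin d → ℝ) (lam : ℝ) (hlam : 0 < lam),
      d ≤ n → 1 ≤ k → k ≤ d →
        1 ≤ RAOD.z a lam k / RAOD.nuM a hlam k ∧
        (k < d → RAOD.z a lam k / RAOD.nuM a hlam k ≤
          min (((d : ℝ) - 1) / ((d : ℝ) - k)) ((n : ℝ) - k + 1)) ∧
        (k = d → RAOD.z a lam k / RAOD.nuM a hlam k ≤ min (d : ℝ) ((n : ℝ) - d + 1))) ∧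
    -- (ii)
    (∀ d k n : ℕ, 1 ≤ d → d + 1 ≤ k → k < n →
      ∃ (a : Fin n → Fin d → ℝ) (lam : ℝ) (hlam : 0 < lam), RAOD.nuM a hlam k < 0) := by
  refine ⟨fun d n k a lam hlam _ _ hk hkn => ⟨RAOD.isLeast_z a lam hkn,
    RAOD.isLeast_nuM a hlam hk hkn⟩, fun d n k a lam hlam hdn hk hkd => ⟨?_, fun hlt => ?_, ?_⟩,
    fun d k n hd hdk hkn => ⟨RAOD.scaledBasis d n, 1, one_pos,
      RAOD.nuM_scaledBasis_neg hd hdk hkn⟩⟩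
  · exact RAOD.one_le_z_div_nuM a hlam hk (hkd.trans hdn) hkd
  · exact RAOD.z_div_nuM_le_of_lt a hlam hk hlt hdn
  · rintro rfl
    exact RAOD.z_div_nuM_le_of_eq a hlam hk hdn
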